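/- Let $(\mathbb X,\mathcal X)$ be a measurable space, let $V:\mathbb X\to[1,+\infty)$ be measurable, and let $\mathcal B_V$ be the complex Banach space of measurable functions $f:\mathbb X\to\mathbb C$ with $\|f\|_V:=\sup_{x}|f(x)|/V(x)<\infty$. Let $P$ be a Markov kernel on $(\mathbb X,\mathcal X)$ such that $PV/V$ is bounded, where $(Pf)(x):=\int f(y)\,P(x,dy)$; so $P$ acts as a bounded linear operator on $\mathcal B_V$. Definitions. Let $L$ be a bounded linear operator on a complex Banach space $\mathcal B$ with spectral radius $r(L)$. $L$ is power-bounded if $\sup_n\|L^n\|<\infty$. For $r_0>0$, say that $L$ splits at level $r_0$ if there are $m\ge1$, $\lambda_1,\dots,\lambda_m\in\mathbb C$, integers $p_1,\dots,p_m\ge1$ and a closed $L$-invariant subspace $H$ with $$\mathcal B=\bigoplus_{i=1}^m\ker(L-\lambda_iI)^{p_i}\oplus H,\qquad |\lambda_i|\ge r_0,\qquad 1\le\dim\ker(L-\lambda_iI)^{p_i}<\infty,\qquad \sup_{h\in H,\,\|h\|\le1}\|L^nh\|=O(r_0^n).$$ $L$ is quasi-compact if it splits at some level $r_0\in(0,r(L))$.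 Its essential spectral radius is $r_{ess}(L):=\lim_n\big(\inf_K\|L^n-K\|\big)^{1/n}$, the infimum being over all compact operators $K$ on $\mathcal B$. For quasi-compact $L$ it is also described as $\inf\{r_0\in(0,r(L)):L\text{ splits at level }r_0\}$. Theorem 2.1. Assume that there are $\varrho\in(0,1)$, $M\in(0,+\infty)$, a set $S\subset\mathbb X$ and a nonzero positive measure $\nu$ on $(\mathbb X,\mathcal X)$ such that $$PV\le\varrho V+M\,1_S\qquad\text{and}\qquad P(x,A)\ge\nu(A)\,1_S(x)\quad\text{for all }x\in\mathbb X,\ A\in\mathcal X.$$ Then (with no irreducibility or aperiodicity assumption) $P$ is a power-bounded quasi-compact operator on $\mathcal B_V$, and $$r_{ess}(P)\le\frac{\varrho\,\nu(1_{\mathbb X})+\tau}{\nu(1_{\mathbb X})+\tau},\qquad\tau:=\max(0,M-\nu(V)),$$ where $\nu(f):=\int f\,d\nu$. The bound holds for $r_{ess}(P)$ in both descriptions above, that is, for the limit and for the infimum. -/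

import Mathlib

open MeasureTheory ProbabilityTheory Filter Topology
open scoped ENNReal

noncomputable section

/-! ### Power-boundedness, quasi-compactness, essential spectral radius -/

section Operators

variable {E : Type*} [NormedAddCommGroup E] [NormedSpace ℂ E]

/-- `L` is power-bounded: `sup_n ‖L ^ n‖ < ∞`. -/
def IsPowerBounded (L : E →L[ℂ] E) : Prop :=
  ∃ C : ℝ, ∀ n : ℕ, ‖L ^ n‖ ≤ C

/-- The generalized eigenspace `ker (L - μ I) ^ p`. -/
def charKer (L : E →L[ℂ] E) (μ : ℂ) (p : ℕ) : Submodule ℂ E :=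
  LinearMap.ker (((L : E →ₗ[ℂ] E) - μ • LinearMap.id) ^ p)

/-- The spectral splitting of `L` at level `r₀`:
`E = ⨁_{i=1}^m ker (L - lam_i I) ^ {p_i} ⊕ H` with `m ≥ 1`, `p_i ≥ 1`, `|lam_i| ≥ r₀`,
`1 ≤ dim ker (L - lam_i I) ^ {p_i} < ∞`, and `H` a closed `L`-invariant subspace on which
`sup_{h ∈ H, ‖h‖ ≤ 1} ‖L ^ n h‖ = O(r₀ ^ n)`.  The index `none` stands for `H`. -/
def HasSpectralSplitting (L : E →L[ℂ] E) (r₀ : ℝ) : Prop :=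
  ∃ (m : ℕ) (lam : Fin m → ℂ) (p : Fin m → ℕ) (H : Submodule ℂ E),
    1 ≤ m ∧ (∀ i, 1 ≤ p i) ∧
    DirectSum.IsInternal
      (fun o : Option (Fin m) => o.elim H (fun i => charKer L (lam i) (p i))) ∧
    (∀ i, r₀ ≤ ‖lam i‖) ∧
    (∀ i, FiniteDimensional ℂ (charKer L (lam i) (p i)) ∧
      1 ≤ Module.finrank ℂ (charKer L (lam i) (p i))) ∧
    IsClosed (H : Set E) ∧ (∀ h ∈ H, L h ∈ H) ∧
    ∃ C : ℝ, ∀ n : ℕ, ∀ h ∈ H, ‖h‖ ≤ 1 → ‖(L ^ n) h‖ ≤ C * r₀ ^ n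

/-- `L` is quasi-compact on the complex Banach space `E`: there is a spectral splitting at some
level `r₀` with `0 < r₀ < r(L)`, where `r(L)` is the spectral radius. -/
def IsQuasiCompact [CompleteSpace E] (L : E →L[ℂ] E) : Prop :=
  ∃ r₀ : ℝ, 0 < r₀ ∧ ENNReal.ofReal r₀ < spectralRadius ℂ L ∧ HasSpectralSplitting L r₀

/-- The essential spectral radius `lim_n (inf_K ‖L ^ n - K‖) ^ (1 / n)`, the infimum being over
all compact operators `K`.  The sequence is nonnegative and bounded by `‖L‖` from `n = 1` on, and
`inf_K ‖L ^ n - K‖` is submultiplicative in `n`, so the limit exists and is the upper limit. -/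
def essSpectralRadius (L : E →L[ℂ] E) : ℝ :=
  limsup (fun n : ℕ =>
    (⨅ K : {K : E →L[ℂ] E // IsCompactOperator K}, ‖L ^ n - K.1‖) ^ (1 / (n : ℝ))) atTop

/-- The spectral description of the essential spectral radius of a quasi-compact operator:
the infimum of the levels `r₀ ∈ (0, r(L))` at which `L` has a spectral splitting. (For a
quasi-compact `L` this set is nonempty, by definition.) -/
def splittingRadius [CompleteSpace E] (L : E →L[ℂ] E) : ℝ :=
  sInf {r₀ : ℝ | 0 < r₀ ∧ ENNReal.ofReal r₀ < spectralRadius ℂ L ∧ HasSpectralSplitting L r₀}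

end Operators

/-! ### The weighted-supremum Banach space and the action of a kernel on it -/

section Weighted

variable {X : Type*} [MeasurableSpace X]

/-- The measurable functions `f : X → ℂ` with `sup_x |f x| / V x < ∞`, as a subspace of all
functions. -/
def weightedSubmodule (V : X → ℝ) (hV : ∀ x, 1 ≤ V x) : Submodule ℂ (X → ℂ) where
  carrier := {f | Measurable f ∧ BddAbove (Set.range fun x => ‖f x‖ / V x)}
  zero_mem' := ⟨measurable_const, 0, by rintro _ ⟨x, rfl⟩; simp⟩
  add_mem' := by
    rintro f g ⟨hf, C, hC⟩ ⟨hg, D, hD⟩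
    refine ⟨hf.add hg, C + D, ?_⟩
    rintro _ ⟨x, rfl⟩
    have h0 : 0 < V x := zero_lt_one.trans_le (hV x)
    have h1 : ‖f x‖ / V x ≤ C := hC ⟨x, rfl⟩
    have h2 : ‖g x‖ / V x ≤ D := hD ⟨x, rfl⟩
    calc ‖f x + g x‖ / V x ≤ (‖f x‖ + ‖g x‖) / V x := by gcongr; exact norm_add_le _ _
      _ = ‖f x‖ / V x + ‖g x‖ / V x := add_div _ _ _
      _ ≤ C + D := add_le_add h1 h2
  smul_mem' := by
    rintro c f ⟨hf, C, hC⟩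
    refine ⟨hf.const_smul c, ‖c‖ * C, ?_⟩
    rintro _ ⟨x, rfl⟩
    have h1 : ‖f x‖ / V x ≤ C := hC ⟨x, rfl⟩
    simp only [Pi.smul_apply, norm_smul, mul_div_assoc]
    gcongr

/-- The space `B_V`. -/
def BV (V : X → ℝ) (hV : ∀ x, 1 ≤ V x) : Type _ := weightedSubmodule V hV

variable {V : X → ℝ} {hV : ∀ x, 1 ≤ V x}

instance : AddCommGroup (BV V hV) := inferInstanceAs (AddCommGroup (weightedSubmodule V hV))
instance : Module ℂ (BV V hV) := inferInstanceAs (Module ℂ (weightedSubmodule V hV))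
instance : CoeFun (BV V hV) (fun _ => X → ℂ) := ⟨fun f => f.1⟩

/-- The norm `‖f‖_V = sup_x |f x| / V x`. -/
instance : Norm (BV V hV) := ⟨fun f => ⨆ x, ‖f x‖ / V x⟩

theorem BV.norm_def (f : BV V hV) : ‖f‖ = ⨆ x, ‖f x‖ / V x := rfl

theorem BV.norm_nonneg' (f : BV V hV) : 0 ≤ ‖f‖ :=
  Real.iSup_nonneg fun x => div_nonneg (norm_nonneg _) (zero_le_one.trans (hV x))

theorem BV.apply_le (f : BV V hV) (x : X) : ‖f x‖ ≤ ‖f‖ * V x :=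
  (div_le_iff₀ (zero_lt_one.trans_le (hV x))).1 (le_ciSup f.2.2 x)

theorem BV.norm_le {f : BV V hV} {C : ℝ} (hC : 0 ≤ C) (h : ∀ x, ‖f x‖ ≤ C * V x) : ‖f‖ ≤ C :=
  Real.iSup_le (fun x => (div_le_iff₀ (zero_lt_one.trans_le (hV x))).2 (h x)) hC

/-- Construction of an element of `B_V` from a bound. -/
def BV.mk (f : X → ℂ) (hf : Measurable f) (C : ℝ) (h : ∀ x, ‖f x‖ ≤ C * V x) : BV V hV :=
  ⟨f, hf, C, by
    rintro _ ⟨x, rfl⟩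
    exact (div_le_iff₀ (zero_lt_one.trans_le (hV x))).2 (h x)⟩

theorem BV.core : NormedSpace.Core ℂ (BV V hV) where
  norm_nonneg := BV.norm_nonneg'
  norm_smul c f := by
    change (⨆ x, ‖c • f x‖ / V x) = ‖c‖ * ⨆ x, ‖f x‖ / V x
    rw [Real.mul_iSup_of_nonneg (norm_nonneg c)]
    simp only [norm_smul, mul_div_assoc]
  norm_triangle f g := by
    refine BV.norm_le (add_nonneg f.norm_nonneg' g.norm_nonneg') fun x => ?_
    rw [add_mul]
    exact (norm_add_le (f x) (g x)).trans (add_le_add (f.apply_le x) (g.apply_le x))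
  norm_eq_zero_iff f := by
    constructor
    · intro h
      apply Subtype.ext
      funext x
      have := f.apply_le x
      rw [h, zero_mul] at this
      exact norm_le_zero_iff.1 this
    · rintro rfl
      exact le_antisymm (BV.norm_le le_rfl fun x => by
        change ‖(0 : ℂ)‖ ≤ _
        simp) (BV.norm_nonneg' _)

instance : NormedAddCommGroup (BV V hV) := NormedAddCommGroup.ofCore BV.core
instance : NormedSpace ℂ (BV V hV) := NormedSpace.ofCore BV.core

instance : CompleteSpace (BV V hV) := by
  refine Metric.complete_of_cauchySeq_tendsto fun u hu => ?_
  have hsub : ∀ n m x, ‖u n x - u m x‖ ≤ ‖u n - u m‖ * V x := fun n m x =>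
    BV.apply_le (u n - u m) x
  have hc : ∀ x, CauchySeq fun n => u n x := by
    intro x
    have h0 : 0 < V x := zero_lt_one.trans_le (hV x)
    rw [Metric.cauchySeq_iff] at hu ⊢
    intro ε hε
    obtain ⟨N, hN⟩ := hu (ε / V x) (div_pos hε h0)
    refine ⟨N, fun m hm n hn => ?_⟩
    have := hN m hm n hn
    rw [dist_eq_norm] at this ⊢
    exact (hsub m n x).trans_lt ((lt_div_iff₀ h0).1 this)
  choose g hg using fun x => cauchySeq_tendsto_of_complete (hc x)
  have hlim : ∀ ε > 0, ∃ N, ∀ n ≥ N, ∀ x, ‖u n x - g x‖ ≤ ε * V x := by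
    intro ε hε
    obtain ⟨N, hN⟩ := Metric.cauchySeq_iff.1 hu ε hε
    refine ⟨N, fun n hn x => ?_⟩
    refine le_of_tendsto ((tendsto_const_nhds.sub (hg x)).norm)
      (eventually_atTop.2 ⟨N, fun m hm => ?_⟩)
    have h1 := hN n hn m hm
    rw [dist_eq_norm] at h1
    exact (hsub n m x).trans
      (mul_le_mul_of_nonneg_right h1.le (zero_le_one.trans (hV x)))
  have hgm : Measurable g :=
    measurable_of_tendsto_metrizable (fun n => (u n).2.1) (tendsto_pi_nhds.2 hg)
  obtain ⟨N, hN⟩ := hlim 1 one_pos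
  refine ⟨BV.mk g hgm (‖u N‖ + 1) fun x => ?_, ?_⟩
  · have h1 := hN N le_rfl x
    have h2 := (u N).apply_le x
    have h3 : ‖g x‖ ≤ ‖u N x‖ + ‖u N x - g x‖ := by
      have := norm_sub_le (u N x) (u N x - g x)
      rwa [sub_sub_cancel] at this
    rw [add_mul]
    linarith
  · rw [Metric.tendsto_atTop]
    intro ε hε
    obtain ⟨N, hN⟩ := hlim (ε / 2) (half_pos hε)
    refine ⟨N, fun n hn => ?_⟩
    rw [dist_eq_norm]
    exact (BV.norm_le (half_pos hε).le (hN n hn)).trans_lt (half_lt_self hε)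

theorem BV.lintegral_le (P : Kernel X X) {C : ℝ}
    (hC : ∀ x, ∫⁻ y, ENNReal.ofReal (V y) ∂(P x) ≤ ENNReal.ofReal (C * V x))
    (f : BV V hV) (x : X) :
    ∫⁻ y, ‖f y‖ₑ ∂(P x) ≤ ENNReal.ofReal (‖f‖ * (C * V x)) := by
  calc ∫⁻ y, ‖f y‖ₑ ∂(P x)
      ≤ ∫⁻ y, ENNReal.ofReal ‖f‖ * ENNReal.ofReal (V y) ∂(P x) := by
        refine lintegral_mono fun y => ?_
        rw [← ENNReal.ofReal_mul f.norm_nonneg', ← ofReal_norm]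
        exact ENNReal.ofReal_le_ofReal (f.apply_le y)
    _ = ENNReal.ofReal ‖f‖ * ∫⁻ y, ENNReal.ofReal (V y) ∂(P x) :=
        lintegral_const_mul' _ _ ENNReal.ofReal_ne_top
    _ ≤ ENNReal.ofReal ‖f‖ * ENNReal.ofReal (C * V x) := by gcongr; exact hC x
    _ = _ := (ENNReal.ofReal_mul f.norm_nonneg').symm

theorem BV.integrable (P : Kernel X X)
    (hP : ∃ C : ℝ, ∀ x, ∫⁻ y, ENNReal.ofReal (V y) ∂(P x) ≤ ENNReal.ofReal (C * V x))
    (f : BV V hV) (x : X) : Integrable (fun y => f y) (P x) := by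
  obtain ⟨C, hC⟩ := hP
  exact ⟨f.2.1.aestronglyMeasurable,
    (BV.lintegral_le P hC f x).trans_lt ENNReal.ofReal_lt_top⟩

theorem BV.norm_integral_le (P : Kernel X X) {C : ℝ} (h0 : 0 ≤ C)
    (hC : ∀ x, ∫⁻ y, ENNReal.ofReal (V y) ∂(P x) ≤ ENNReal.ofReal (C * V x))
    (f : BV V hV) (x : X) : ‖∫ y, f y ∂(P x)‖ ≤ (C * ‖f‖) * V x := by
  have h := (enorm_integral_le_lintegral_enorm (μ := P x) (fun y => f y)).trans
    (BV.lintegral_le P hC f x)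
  rw [← ofReal_norm, ENNReal.ofReal_le_ofReal_iff
    (mul_nonneg f.norm_nonneg' (mul_nonneg h0 (zero_le_one.trans (hV x))))] at h
  linarith

theorem BV.bound_max {P : Kernel X X}
    (hP : ∃ C : ℝ, ∀ x, ∫⁻ y, ENNReal.ofReal (V y) ∂(P x) ≤ ENNReal.ofReal (C * V x))
    (hV : ∀ x, 1 ≤ V x) :
    ∃ C : ℝ, 0 ≤ C ∧ ∀ x, ∫⁻ y, ENNReal.ofReal (V y) ∂(P x) ≤ ENNReal.ofReal (C * V x) := by
  obtain ⟨C, hC⟩ := hP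
  exact ⟨max C 0, le_max_right _ _, fun x => (hC x).trans (ENNReal.ofReal_le_ofReal
    (mul_le_mul_of_nonneg_right (le_max_left _ _) (zero_le_one.trans (hV x))))⟩

/-- The bounded operator `f ↦ P f`, `(P f) x = ∫ f(y) P(x, dy)`, on `B_V`, for a kernel `P` such
that `P V / V` is bounded. -/
def kernelOp (V : X → ℝ) (hV : ∀ x, 1 ≤ V x) (P : Kernel X X) [IsMarkovKernel P]
    (hP : ∃ C : ℝ, ∀ x, ∫⁻ y, ENNReal.ofReal (V y) ∂(P x) ≤ ENNReal.ofReal (C * V x)) :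
    BV V hV →L[ℂ] BV V hV :=
  LinearMap.mkContinuousOfExistsBound
    { toFun := fun f => BV.mk (fun x => ∫ y, f y ∂(P x))
        (f.2.1.stronglyMeasurable.integral_kernel (κ := P)).measurable
        ((BV.bound_max hP hV).choose * ‖f‖)
        (BV.norm_integral_le P (BV.bound_max hP hV).choose_spec.1
          (BV.bound_max hP hV).choose_spec.2 f)
      map_add' := fun f g => Subtype.ext <| funext fun x =>
        integral_add (BV.integrable P hP f x) (BV.integrable P hP g x)
      map_smul' := fun c f => Subtype.ext <| funext fun _ =>
        integral_const_mul c (fun y => f y) }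
    ⟨(BV.bound_max hP hV).choose, fun f =>
      BV.norm_le (mul_nonneg (BV.bound_max hP hV).choose_spec.1 f.norm_nonneg')
        (BV.norm_integral_le P (BV.bound_max hP hV).choose_spec.1
          (BV.bound_max hP hV).choose_spec.2 f)⟩

theorem kernelOp_apply (P : Kernel X X) [IsMarkovKernel P]
    (hP : ∃ C : ℝ, ∀ x, ∫⁻ y, ENNReal.ofReal (V y) ∂(P x) ≤ ENNReal.ofReal (C * V x))
    (f : BV V hV) (x : X) : kernelOp V hV P hP f x = ∫ y, f y ∂(P x) := rfl

end Weighted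

end

/-!
The idea is to subtract from `P` the rank-one operator `f ↦ ν(f) 1_A` that the minorization condition
provides.  The remainder `T f = P f - ν(f) 1_A` still has a nonnegative kernel, and
`T 1 = 1 - ν(1) 1_A`, `T V ≤ ϱ V + (M - ν(V)) 1_A`.  With `c = τ / ν(1)` the weight `V + c`, which is
equivalent to `V`, therefore satisfies `T (V + c) ≤ ϱ V + c ≤ α (V + c)` for
`α = (ϱ + c) / (1 + c) = (ϱ ν(1) + τ) / (ν(1) + τ) < 1`, the second inequality because
`V ≥ 1`.  Hence `‖T ^ n‖ ≤ (1 + c) α ^ n` (`norm_residualOp_pow_le`).  The set `S` is not assumed measurable;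
`A` is the measurable subset of `S` on which `P V ≤ ϱ V` fails, and it inherits both hypotheses.

As `P ^ n - T ^ n` has finite rank, this bounds the limit defining the essential spectral radius by `α`
(`essSpectralRadius_le_of_rankOne`).

For the spectral description, let `L = T + φ(·) s` be any rank-one perturbation of an operator `T` whose
spectrum lies in `‖z‖ ≤ α`.  For `‖z‖ > α`, the operator `L - z` is Fredholm of index zero, and it is
invertible exactly when the analytic function `D z = 1 - φ ((z - T)⁻¹ s)` does not vanish.  As `D` is
not identically zero, `L` has finitely many spectral values of modulus at least `r > α`
(`finite_spectrum_of_rankOne`), and at each of them the kernels of the powers of `L - z` stabilize, at an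
exponent bounded in terms of the order of vanishing of `D` (`exists_ker_pow_eq_ker_pow_succ`).
The product `B` of the stabilized powers `(L - z) ^ p` is again Fredholm of index zero with `ker B = ker (B ^ 2)`, so the
space is the direct sum of `ker B`, which splits into the generalized eigenspaces, and `H = range B`.
On `H` there is no spectrum left in `‖z‖ ≥ r`, and Gelfand's formula gives `‖L ^ n‖ = O(r ^ n)` there
(`hasSpectralSplitting_of_rankOne`).

Since `P 1 = 1`, the spectral radius is at least `1 > α`, so every level in `(α, 1)` is admissible.
-/

noncomputable section

/-! ### Fredholm operators of index zero -/

section FredholmIndexZero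

variable {E : Type*} [AddCommGroup E] [Module ℂ E]

/-- `f` has finite-dimensional kernel and cokernel, of the same dimension: it is algebraically a
Fredholm operator of index zero. -/
structure IsFredholmIndexZero (f : Module.End ℂ E) : Prop where
  finite_ker : FiniteDimensional ℂ (LinearMap.ker f)
  finite_coker : FiniteDimensional ℂ (E ⧸ LinearMap.range f)
  index_eq_zero : f.index = 0

theorem IsFredholmIndexZero.one : IsFredholmIndexZero (1 : Module.End ℂ E) where
  finite_ker := by
    rw [show LinearMap.ker (1 : Module.End ℂ E) = ⊥ from LinearMap.ker_id]; infer_instance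
  finite_coker := by
    rw [show LinearMap.range (1 : Module.End ℂ E) = ⊤ from LinearMap.range_id]; infer_instance
  index_eq_zero := LinearMap.index_id

theorem IsFredholmIndexZero.mul {f g : Module.End ℂ E} (hf : IsFredholmIndexZero f)
    (hg : IsFredholmIndexZero g) : IsFredholmIndexZero (f * g) := by
  have := hf.finite_ker
  have := hf.finite_coker
  have := hg.finite_ker
  have := hg.finite_coker
  refine ⟨?_, ?_, ?_⟩
  · rw [Module.End.mul_eq_comp, LinearMap.ker_comp]; infer_instance
  · rw [Module.End.mul_eq_comp, LinearMap.range_comp]; infer_instance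
  · rw [Module.End.mul_eq_comp, LinearMap.index_comp, hf.index_eq_zero, hg.index_eq_zero,
      add_zero]

/-- If kernel and range of an index zero Fredholm operator meet trivially, the kernel embeds into
the cokernel, so by equality of dimensions they are complementary. -/
theorem IsFredholmIndexZero.isCompl {f : Module.End ℂ E} (hf : IsFredholmIndexZero f)
    (h : Disjoint (LinearMap.ker f) (LinearMap.range f)) :
    IsCompl (LinearMap.ker f) (LinearMap.range f) := by
  have := hf.finite_ker
  have := hf.finite_coker
  refine ⟨h, codisjoint_iff.2 ?_⟩
  let j : LinearMap.ker f →ₗ[ℂ] E ⧸ LinearMap.range f :=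
    (LinearMap.range f).mkQ ∘ₗ (LinearMap.ker f).subtype
  have hj : Function.Injective j := by
    rw [← LinearMap.ker_eq_bot, LinearMap.ker_eq_bot']
    rintro ⟨x, hx⟩ h0
    have h1 : x ∈ LinearMap.range f := by simpa [j] using h0
    exact Subtype.ext (Submodule.disjoint_def.1 h x hx h1)
  have hdim : Module.finrank ℂ (LinearMap.ker f) = Module.finrank ℂ (E ⧸ LinearMap.range f) := by
    have := hf.index_eq_zero
    rw [LinearMap.index_eq_finrank_sub] at this
    omega
  have hs := (LinearMap.injective_iff_surjective_of_finrank_eq_finrank hdim).1 hj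
  rw [eq_top_iff]
  intro x _
  obtain ⟨⟨k, hk⟩, hkx⟩ := hs ((LinearMap.range f).mkQ x)
  have h2 : x - k ∈ LinearMap.range f := by
    have := (Submodule.Quotient.eq _).1 hkx
    simpa using (LinearMap.range f).neg_mem this
  exact Submodule.mem_sup.2 ⟨k, hk, x - k, h2, by abel⟩

end FredholmIndexZero

section ClosedRange

/-- A bounded operator on a Banach space whose kernel is finite-dimensional and complementary to
its range has closed range. -/
theorem isClosed_range_of_isCompl_ker {E : Type*} [NormedAddCommGroup E] [NormedSpace ℂ E]
    [CompleteSpace E] (f : E →L[ℂ] E) [FiniteDimensional ℂ (LinearMap.ker (f : E →ₗ[ℂ] E))]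
    (h : IsCompl (LinearMap.ker (f : E →ₗ[ℂ] E)) (LinearMap.range (f : E →ₗ[ℂ] E))) :
    IsClosed (LinearMap.range (f : E →ₗ[ℂ] E) : Set E) := by
  obtain ⟨K, hKc, hK⟩ := (Submodule.ClosedComplemented.of_finiteDimensional
    (LinearMap.ker (f : E →ₗ[ℂ] E))).exists_isClosed_isCompl
  have : CompleteSpace K := hKc.completeSpace_coe
  have hr : LinearMap.range (f ∘L K.subtypeL : K →ₗ[ℂ] E) = LinearMap.range (f : E →ₗ[ℂ] E) := by
    apply le_antisymm
    · rintro _ ⟨x, rfl⟩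
      exact ⟨x, rfl⟩
    · rintro _ ⟨x, rfl⟩
      obtain ⟨k, hk, y, hy, rfl⟩ := Submodule.mem_sup.1 (hK.sup_eq_top ▸ Submodule.mem_top (x := x))
      refine ⟨⟨y, hy⟩, ?_⟩
      have hk0 : f k = 0 := hk
      simp [hk0]
  rw [← hr]
  refine ContinuousLinearMap.closed_complemented_range_of_isCompl_of_ker_eq_bot _
    (LinearMap.ker (f : E →ₗ[ℂ] E)) (hr ▸ h.symm) (Submodule.closed_of_finiteDimensional _) ?_
  rw [LinearMap.ker_eq_bot']
  rintro ⟨y, hy⟩ h0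
  exact Subtype.ext (Submodule.disjoint_def.1 hK.disjoint y h0 hy)

end ClosedRange

/-! ### Kernels of products of powers, and direct sums -/

section GeneralizedEigenspaces

open Polynomial

variable {E : Type*} [AddCommGroup E] [Module ℂ E] {ι : Type*}

theorem aeval_X_sub_C_pow (f : Module.End ℂ E) (μ : ℂ) (n : ℕ) :
    aeval f ((X - C μ) ^ n) = (f - μ • LinearMap.id) ^ n := by
  rw [map_pow, map_sub, aeval_X, aeval_C, Algebra.algebraMap_eq_smul_one]
  rfl

theorem ker_aeval_prod_X_sub_C_pow (f : Module.End ℂ E) {lam : ι → ℂ}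
    (hlam : Function.Injective lam) (e : ι → ℕ) (s : Finset ι) :
    LinearMap.ker (aeval f (∏ i ∈ s, (X - C (lam i)) ^ e i)) =
      ⨆ i ∈ s, LinearMap.ker ((f - lam i • LinearMap.id) ^ e i) := by
  classical
  induction s using Finset.induction_on with
  | empty =>
    rw [Finset.prod_empty, map_one, show LinearMap.ker (1 : Module.End ℂ E) = ⊥ from
      LinearMap.ker_id]
    simp
  | insert a s ha ih =>
    rw [Finset.prod_insert ha, Finset.iSup_insert, ← ih, ← aeval_X_sub_C_pow,
      sup_ker_aeval_eq_ker_aeval_mul_of_coprime]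
    refine IsCoprime.prod_right fun i hi => IsCoprime.pow ?_
    exact pairwise_coprime_X_sub_C hlam fun h => ha (h ▸ hi)

theorem iSupIndep_ker_sub_pow (f : Module.End ℂ E) {lam : ι → ℂ}
    (hlam : Function.Injective lam) (e : ι → ℕ) :
    iSupIndep fun i => LinearMap.ker ((f - lam i • LinearMap.id) ^ e i) := by
  have h := (f.independent_maxGenEigenspace).comp hlam
  refine h.mono fun i x hx => ?_
  exact (f.genEigenspace (lam i)).monotone le_top (Module.End.mem_genEigenspace_nat.2 hx)

theorem ker_pow_mul_two_of_ker_pow_succ {f : Module.End ℂ E} {k : ℕ}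
    (h : LinearMap.ker (f ^ k) = LinearMap.ker (f ^ (k + 1))) :
    LinearMap.ker (f ^ (k * 2)) = LinearMap.ker (f ^ k) := by
  rw [mul_two, ← Module.End.ker_pow_constant h k]

/-- Adjoining a complement of `⨆ i, t i` to an independent family, at the index `none`, gives an
internal direct sum. -/
theorem isInternal_option_of_isCompl [DecidableEq ι] {t : ι → Submodule ℂ E} {H : Submodule ℂ E}
    (ht : iSupIndep t) (hH : IsCompl (⨆ i, t i) H) :
    DirectSum.IsInternal (fun o : Option ι => o.elim H t) := by
  rw [DirectSum.isInternal_submodule_iff_iSupIndep_and_iSup_eq_top]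
  refine ⟨?_, ?_⟩
  · rintro (_ | i)
    · refine hH.disjoint.symm.mono_right (iSup₂_le ?_)
      rintro (_ | j) hj
      · exact absurd rfl hj
      · exact le_iSup t j
    · have h1 : Disjoint (t i) ((⨆ (j) (_ : j ≠ i), t j) ⊔ H) := by
        refine Disjoint.disjoint_sup_right_of_disjoint_sup_left (ht i) (hH.disjoint.mono_left ?_)
        exact sup_le (le_iSup t i) (iSup₂_le fun j _ => le_iSup t j)
      refine h1.mono_right (iSup₂_le ?_)
      rintro (_ | j) hj
      · exact le_sup_right
      · have hji : j ≠ i := fun h => hj (congrArg some h)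
        exact le_sup_of_le_left (le_iSup₂_of_le j hji le_rfl)
  · rw [iSup_option]
    simpa [sup_comm] using hH.sup_eq_top

end GeneralizedEigenspaces

/-! ### Growth of powers and the spectrum -/

section Growth

/-- If the spectrum of `A` lies in `‖z‖ < r`, then `‖A ^ n‖ = O(r ^ n)`. -/
theorem exists_norm_pow_le_of_spectrum {A : Type*} [NormedRing A] [NormedAlgebra ℂ A]
    [CompleteSpace A] (a : A) {r : ℝ} (hr : 0 < r) (h : ∀ z ∈ spectrum ℂ a, ‖z‖ < r) :
    ∃ C : ℝ, ∀ n : ℕ, ‖a ^ n‖ ≤ C * r ^ n := by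
  have hsr : spectralRadius ℂ a < ENNReal.ofReal r := by
    rcases (spectrum ℂ a).eq_empty_or_nonempty with h0 | hne
    · simp [spectralRadius, h0, hr]
    · obtain ⟨k, hk, hkr⟩ := spectrum.exists_nnnorm_eq_spectralRadius_of_nonempty hne
      rw [← hkr, ← enorm_eq_nnnorm, ← ofReal_norm]
      exact (ENNReal.ofReal_lt_ofReal_iff hr).2 (h k hk)
  have hev := (spectrum.pow_norm_pow_one_div_tendsto_nhds_spectralRadius a).eventually_lt_const hsr
  have hO : (fun n : ℕ => a ^ n) =O[atTop] fun n : ℕ => r ^ n := by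
    refine Asymptotics.IsBigO.of_bound 1 ?_
    filter_upwards [hev, eventually_gt_atTop 0] with n hn hn0
    have h1 := (ENNReal.ofReal_lt_ofReal_iff hr).1 hn
    have h2 : ‖a ^ n‖ ≤ r ^ n := by
      have h3 := pow_le_pow_left₀ (by positivity) h1.le n
      rwa [one_div, Real.rpow_inv_natCast_pow (norm_nonneg _) hn0.ne'] at h3
    simpa [abs_of_pos hr] using h2
  obtain ⟨C, -, hC⟩ := Asymptotics.bound_of_isBigO_nat_atTop hO
  refine ⟨C, fun n => ?_⟩
  simpa [abs_of_pos hr] using hC (pow_ne_zero n hr.ne')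

end Growth

/-! ### Spectral theory of a rank-one perturbation -/

section RankOnePerturbation

variable {E : Type*} [NormedAddCommGroup E] [NormedSpace ℂ E]

/-- The determinant `1 - φ ((z - T)⁻¹ s)` of the rank-one perturbation `T + φ(·) s` of `T`.  On the
resolvent set of `T`, its zeros are the spectral values of the perturbed operator. -/
def rankOneDet (T : E →L[ℂ] E) (φ : E →L[ℂ] ℂ) (s : E) (z : ℂ) : ℂ :=
  1 - φ (resolvent T z s)

theorem resolvent_smul_sub_apply {T : E →L[ℂ] E} {z : ℂ} (hz : z ∈ resolventSet ℂ T) (x : E) :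
    resolvent T z (z • x - T x) = x := by
  have h := Ring.inverse_mul_cancel _ (spectrum.mem_resolventSet_iff.1 hz)
  simpa [Algebra.algebraMap_eq_smul_one] using! DFunLike.congr_fun h x

theorem smul_sub_resolvent_apply {T : E →L[ℂ] E} {z : ℂ} (hz : z ∈ resolventSet ℂ T) (x : E) :
    z • resolvent T z x - T (resolvent T z x) = x := by
  have h := Ring.mul_inverse_cancel _ (spectrum.mem_resolventSet_iff.1 hz)
  simpa [Algebra.algebraMap_eq_smul_one] using! DFunLike.congr_fun h x

variable {L T : E →L[ℂ] E} {φ : E →L[ℂ] ℂ} {s : E} {z : ℂ}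

/-- An eigenvector of the rank-one perturbation is a multiple of `(z - T)⁻¹ s`. -/
theorem eq_smul_resolvent_of_apply_eq_smul (hL : ∀ x, L x = T x + φ x • s)
    (hz : z ∈ resolventSet ℂ T) {x : E} (hx : L x = z • x) :
    x = φ x • resolvent T z s := by
  have h1 : z • x - T x = φ x • s := by rw [← hx, hL]; abel
  rw [← map_smul, ← h1, resolvent_smul_sub_apply hz]

theorem apply_resolvent_of_rankOneDet_eq_zero (hL : ∀ x, L x = T x + φ x • s)
    (hz : z ∈ resolventSet ℂ T) (h0 : rankOneDet T φ s z = 0) :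
    L (resolvent T z s) = z • resolvent T z s ∧ φ (resolvent T z s) = 1 := by
  have h1 : φ (resolvent T z s) = 1 := (sub_eq_zero.1 h0).symm
  refine ⟨?_, h1⟩
  have h2 := smul_sub_resolvent_apply hz s
  rw [hL, h1, one_smul]
  nth_rw 2 [← h2]
  abel

theorem bijective_sub_of_rankOneDet_ne_zero (hL : ∀ x, L x = T x + φ x • s)
    (hz : z ∈ resolventSet ℂ T) (h0 : rankOneDet T φ s z ≠ 0) :
    Function.Bijective ((L : E →ₗ[ℂ] E) - z • LinearMap.id : E →ₗ[ℂ] E) := by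
  constructor
  · rw [← LinearMap.ker_eq_bot, LinearMap.ker_eq_bot']
    intro x hx
    have hx1 : L x = z • x := by simpa [sub_eq_zero] using hx
    have hx2 := eq_smul_resolvent_of_apply_eq_smul hL hz hx1
    have hx3 : φ x * rankOneDet T φ s z = 0 := by
      have := congrArg φ hx2
      rw [map_smul, smul_eq_mul] at this
      rw [rankOneDet, mul_sub, mul_one, ← this, sub_self]
    rw [hx2, (mul_eq_zero.1 hx3).resolve_right h0, zero_smul]
  · intro y
    set c : ℂ := -φ (resolvent T z y) / rankOneDet T φ s z with hc
    refine ⟨c • resolvent T z s - resolvent T z y, ?_⟩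
    have hφ : φ (c • resolvent T z s - resolvent T z y) = c := by
      have h1 : c * rankOneDet T φ s z = -φ (resolvent T z y) := div_mul_cancel₀ _ h0
      rw [rankOneDet] at h1
      rw [map_sub, map_smul, smul_eq_mul]
      linear_combination -h1
    have h2 := smul_sub_resolvent_apply hz s
    have h3 := smul_sub_resolvent_apply hz y
    change L (c • resolvent T z s - resolvent T z y) -
      z • (c • resolvent T z s - resolvent T z y) = y
    rw [hL, hφ, map_sub, map_smul]
    linear_combination (norm := module) h3 - c • h2

theorem isFredholmIndexZero_of_bijective {f : Module.End ℂ E} (hf : Function.Bijective f) :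
    IsFredholmIndexZero f where
  finite_ker := by rw [LinearMap.ker_eq_bot.2 hf.1]; infer_instance
  finite_coker := by rw [LinearMap.range_eq_top.2 hf.2]; infer_instance
  index_eq_zero := (LinearEquiv.ofBijective f hf).index_eq_zero

/-- A rank-one perturbation of an invertible operator is Fredholm of index zero.  At a zero of the
determinant the kernel is the line through `(z - T)⁻¹ s` and the range is the hyperplane
`φ ((z - T)⁻¹ y) = 0`. -/
theorem isFredholmIndexZero_sub (hL : ∀ x, L x = T x + φ x • s) (hz : z ∈ resolventSet ℂ T) :
    IsFredholmIndexZero ((L : E →ₗ[ℂ] E) - z • LinearMap.id) := by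
  by_cases h0 : rankOneDet T φ s z = 0
  swap
  · exact isFredholmIndexZero_of_bijective (bijective_sub_of_rankOneDet_ne_zero hL hz h0)
  obtain ⟨hu, hφu⟩ := apply_resolvent_of_rankOneDet_eq_zero hL hz h0
  set u := resolvent T z s with hu_def
  have hu0 : u ≠ 0 := by
    intro h
    rw [h, map_zero] at hφu
    exact zero_ne_one hφu
  have hker : LinearMap.ker ((L : E →ₗ[ℂ] E) - z • LinearMap.id) = ℂ ∙ u := by
    ext x
    rw [Submodule.mem_span_singleton]
    constructor
    · intro hx
      have hx1 : L x = z • x := by simpa [sub_eq_zero] using hx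
      exact ⟨φ x, (eq_smul_resolvent_of_apply_eq_smul hL hz hx1).symm⟩
    · rintro ⟨c, rfl⟩
      simp [hu]
  let ψ : E →ₗ[ℂ] ℂ := (φ ∘L resolvent T z : E →L[ℂ] ℂ)
  have hψ : Function.Surjective ψ := fun c => ⟨c • s, by simp [ψ, ← hu_def, hφu]⟩
  have hrange : LinearMap.range ((L : E →ₗ[ℂ] E) - z • LinearMap.id) = LinearMap.ker ψ := by
    ext y
    constructor
    · rintro ⟨x, rfl⟩
      have h1 : L x - z • x = φ x • s - (z • x - T x) := by rw [hL]; abel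
      change φ (resolvent T z (L x - z • x)) = 0
      rw [h1, map_sub, resolvent_smul_sub_apply hz, map_smul, map_sub, map_smul, ← hu_def, hφu]
      simp
    · intro hy
      have hy0 : φ (resolvent T z y) = 0 := hy
      refine ⟨-resolvent T z y, ?_⟩
      have h3 := smul_sub_resolvent_apply hz y
      change L (-resolvent T z y) - z • (-resolvent T z y) = y
      rw [hL, map_neg, map_neg, hy0, neg_zero, zero_smul]
      linear_combination (norm := module) h3
  have e : (E ⧸ LinearMap.ker ψ) ≃ₗ[ℂ] ℂ := ψ.quotKerEquivOfSurjective hψ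
  refine ⟨?_, ?_, ?_⟩
  · rw [hker]; infer_instance
  · rw [hrange]; exact e.symm.finiteDimensional
  · rw [LinearMap.index_eq_finrank_sub, hker, hrange, finrank_span_singleton hu0, e.finrank_eq,
      Module.finrank_self]
    simp

theorem mem_spectrum_iff_rankOneDet_eq_zero [CompleteSpace E] (hL : ∀ x, L x = T x + φ x • s)
    (hz : z ∈ resolventSet ℂ T) : z ∈ spectrum ℂ L ↔ rankOneDet T φ s z = 0 := by
  rw [ContinuousLinearMap.spectrum_eq]
  constructor
  · intro h
    by_contra h0
    refine h ?_
    rw [spectrum.mem_resolventSet_iff, ← IsUnit.neg_iff, Module.End.isUnit_iff, neg_sub]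
    exact bijective_sub_of_rankOneDet_ne_zero hL hz h0
  · intro h0
    obtain ⟨hu, hφu⟩ := apply_resolvent_of_rankOneDet_eq_zero hL hz h0
    refine Module.End.HasEigenvalue.mem_spectrum
      (Module.End.hasEigenvalue_of_hasEigenvector (x := resolvent T z s) ⟨?_, ?_⟩)
    · exact Module.End.mem_eigenspace_iff.2 hu
    · intro h
      rw [h, map_zero] at hφu
      exact zero_ne_one hφu

variable [CompleteSpace E]

theorem differentiableAt_rankOneDet (hz : z ∈ resolventSet ℂ T) :
    DifferentiableAt ℂ (rankOneDet T φ s) z := by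
  have h := (spectrum.hasDerivAt_resolvent_const_left hz).differentiableAt
  have h1 : DifferentiableAt ℂ (fun z => resolvent T z s) z :=
    h.clm_apply (differentiableAt_const s)
  exact (differentiableAt_const _).sub (φ.differentiableAt.comp z h1)

theorem isPreconnected_setOf_lt_norm (a : ℝ) :
    IsPreconnected {z : ℂ | a < ‖z‖} := by
  have h : {z : ℂ | a < ‖z‖} =
      (fun q : ℝ × ℝ => (q.1 : ℂ) * Complex.exp (q.2 * Complex.I)) '' (Set.Ioi a ×ˢ Set.univ) := by
    ext z
    constructor
    · intro hz
      exact ⟨(‖z‖, z.arg), ⟨hz, trivial⟩, Complex.norm_mul_exp_arg_mul_I z⟩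
    · rintro ⟨⟨r, θ⟩, ⟨hr, -⟩, rfl⟩
      have hr' : a < r := hr
      simpa [Complex.norm_exp_ofReal_mul_I] using hr'.trans_le (le_abs_self r)
  rw [h]
  refine (isPreconnected_Ioi.prod isPreconnected_univ).image _ (Continuous.continuousOn ?_)
  fun_prop

theorem analyticOnNhd_rankOneDet {a : ℝ}
    (ha : ∀ z : ℂ, a < ‖z‖ → z ∈ resolventSet ℂ T) :
    AnalyticOnNhd ℂ (rankOneDet T φ s) {z | a < ‖z‖} :=
  DifferentiableOn.analyticOnNhd
    (fun z hz => (differentiableAt_rankOneDet (ha z hz)).differentiableWithinAt)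
    (isOpen_lt continuous_const continuous_norm)

/-- The determinant has isolated zeros: it is analytic on the connected set `a < ‖z‖`, and it does
not vanish outside the spectrum of the perturbed operator, hence not for large `z`. -/
theorem not_frequently_rankOneDet_eq_zero {a : ℝ} (ha0 : 0 ≤ a)
    (ha : ∀ z : ℂ, a < ‖z‖ → z ∈ resolventSet ℂ T)
    (hL : ∀ x, L x = T x + φ x • s) {z : ℂ} (hz : a < ‖z‖) :
    ¬ ∃ᶠ w in 𝓝[≠] z, rankOneDet T φ s w = 0 := by
  intro hf
  have h := (analyticOnNhd_rankOneDet (φ := φ) (s := s)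
    ha).eqOn_zero_of_preconnected_of_frequently_eq_zero (isPreconnected_setOf_lt_norm a) hz hf
  set R : ℝ := a + ‖L‖ * ‖(1 : E →L[ℂ] E)‖ + 1 with hR
  have hR0 : 0 ≤ ‖L‖ * ‖(1 : E →L[ℂ] E)‖ := by positivity
  have hRn : ‖(R : ℂ)‖ = R := by
    rw [Complex.norm_real, Real.norm_eq_abs, abs_of_nonneg (by positivity)]
  have hRa : a < ‖(R : ℂ)‖ := by rw [hRn]; linarith
  have h1 := (mem_spectrum_iff_rankOneDet_eq_zero hL (ha _ hRa)).2 (h hRa)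
  have h2 := spectrum.norm_le_norm_mul_of_mem h1
  rw [hRn] at h2
  linarith

theorem finite_spectrum_of_rankOne {a : ℝ} (ha0 : 0 ≤ a)
    (ha : ∀ z : ℂ, a < ‖z‖ → z ∈ resolventSet ℂ T)
    (hL : ∀ x, L x = T x + φ x • s) {r : ℝ} (har : a < r) :
    {z ∈ spectrum ℂ L | r ≤ ‖z‖}.Finite := by
  by_contra hinf
  have hK : IsCompact {z ∈ spectrum ℂ L | r ≤ ‖z‖} :=
    (spectrum.isCompact L).inter_right (isClosed_le continuous_const continuous_norm)
  obtain ⟨w, hw, hacc⟩ := Set.Infinite.exists_accPt_of_subset_isCompact hinf hK subset_rfl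
  have haw : a < ‖w‖ := har.trans_le hw.2
  refine not_frequently_rankOneDet_eq_zero ha0 ha hL haw ?_
  rw [accPt_iff_frequently_nhdsNE] at hacc
  exact hacc.mono fun z hz =>
    (mem_spectrum_iff_rankOneDet_eq_zero hL (ha z (har.trans_le hz.2))).1 hz.1

/-- The kernels of the powers of `L - z` stabilize.  With `A = L - z`, a vector `y` such that
`A ^ p y = 0 ≠ A ^ (p - 1) y` gives the polynomial `u w = ∑ (w - z) ^ j A ^ (p - 1 - j) y`, for
which `(w - L) (u w) = (w - z) ^ p y`.  Applying `φ ∘ (w - T)⁻¹` shows that the determinant times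
`φ (u w)` vanishes at `z` to order at least `p`, while `φ (u z) ≠ 0`.  So `p` is at most the order
of vanishing of the determinant at `z`. -/
theorem exists_ker_pow_eq_ker_pow_succ {a : ℝ} (ha0 : 0 ≤ a)
    (ha : ∀ z : ℂ, a < ‖z‖ → z ∈ resolventSet ℂ T)
    (hL : ∀ x, L x = T x + φ x • s) {z : ℂ} (hz : a < ‖z‖) :
    ∃ p : ℕ, 1 ≤ p ∧ LinearMap.ker (((L : E →ₗ[ℂ] E) - z • LinearMap.id) ^ p) =
      LinearMap.ker (((L : E →ₗ[ℂ] E) - z • LinearMap.id) ^ (p + 1)) := by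
  have hnz : ¬ ∀ᶠ w in 𝓝 z, rankOneDet T φ s w = 0 := fun h =>
    not_frequently_rankOneDet_eq_zero ha0 ha hL hz
      (((analyticOnNhd_rankOneDet ha z hz).frequently_zero_iff_eventually_zero).2 h)
  obtain ⟨n, g, hg, hg0, hgD⟩ := (AnalyticAt.exists_eventuallyEq_pow_smul_nonzero_iff
    (analyticOnNhd_rankOneDet ha z hz)).2 hnz
  refine ⟨n + 1, by omega, ?_⟩
  set A : Module.End ℂ E := (L : E →ₗ[ℂ] E) - z • LinearMap.id with hA
  refine le_antisymm (fun x hx => ?_) fun y hy => ?_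
  · rw [LinearMap.mem_ker] at hx ⊢
    rw [pow_succ', Module.End.mul_apply, hx, map_zero]
  rw [LinearMap.mem_ker] at hy ⊢
  -- The vector `A ^ (n + 1) y` is in the eigenspace, where it suffices to show that `φ` vanishes.
  have heig : L ((A ^ (n + 1)) y) = z • (A ^ (n + 1)) y := by
    rw [pow_succ', Module.End.mul_apply] at hy
    exact sub_eq_zero.1 hy
  suffices hφ0 : φ ((A ^ (n + 1)) y) = 0 by
    rw [eq_smul_resolvent_of_apply_eq_smul hL (ha z hz) heig, hφ0, zero_smul]
  set u : ℂ → E := fun w =>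
    ∑ j ∈ Finset.range (n + 2), (w - z) ^ j • (A ^ (n + 2 - 1 - j)) y with hu
  have huz : u z = (A ^ (n + 1)) y := by
    rw [hu]
    simp [Finset.sum_range_succ']
  have hLu : ∀ w, w • u w - L (u w) = (w - z) ^ (n + 2) • y := by
    intro w
    have hc : Commute (algebraMap ℂ (Module.End ℂ E) (w - z)) A := Algebra.commutes (w - z) A
    have h1 := DFunLike.congr_fun (hc.mul_geom_sum₂ (n + 2)) y
    simp only [← map_pow, Module.End.mul_apply, LinearMap.sum_apply, LinearMap.sub_apply,
      Module.algebraMap_end_apply, hy, sub_zero] at h1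
    rw [← h1, hA]
    change w • u w - L (u w) = (w - z) • u w - (L (u w) - z • u w)
    module
  have hid : ∀ w, a < ‖w‖ →
      φ (u w) * rankOneDet T φ s w = (w - z) ^ (n + 2) * φ (resolvent T w y) := by
    intro w hw
    have h1 : w • u w - T (u w) = φ (u w) • s + (w - z) ^ (n + 2) • y := by
      rw [← hLu w, hL]; abel
    have h2 := congrArg (fun v => φ (resolvent T w v)) h1
    simp only [resolvent_smul_sub_apply (ha w hw), map_add, map_smul, smul_eq_mul] at h2
    rw [rankOneDet]
    linear_combination h2
  have hopen : ∀ᶠ w in 𝓝 z, a < ‖w‖ :=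
    (isOpen_lt continuous_const continuous_norm).mem_nhds hz
  have hev : ∀ᶠ w in 𝓝[≠] z, φ (u w) * g w = (w - z) ^ 2 * φ (resolvent T w y) := by
    filter_upwards [nhdsWithin_le_nhds hopen, nhdsWithin_le_nhds hgD, self_mem_nhdsWithin]
      with w hw hgw hne
    have h1 := hid w hw
    rw [hgw, smul_eq_mul] at h1
    refine mul_left_cancel₀ (pow_ne_zero n (sub_ne_zero.2 hne)) ?_
    linear_combination h1
  have hc1 : Tendsto (fun w => φ (u w) * g w) (𝓝[≠] z) (𝓝 (φ (u z) * g z)) := by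
    have hcu : Continuous u := by fun_prop
    exact ((φ.continuous.comp hcu).continuousAt.mul hg.continuousAt).tendsto.mono_left
      nhdsWithin_le_nhds
  have hc2 : Tendsto (fun w => (w - z) ^ 2 * φ (resolvent T w y)) (𝓝[≠] z)
      (𝓝 ((z - z) ^ 2 * φ (resolvent T z y))) := by
    have h := (spectrum.hasDerivAt_resolvent_const_left (ha z hz)).continuousAt
    have h1 : ContinuousAt (fun w => resolvent T w y) z := h.clm_apply continuousAt_const
    have h2 : ContinuousAt (fun w => (w - z) ^ 2 * φ (resolvent T w y)) z :=
      ((continuousAt_id.sub continuousAt_const).pow 2).mul (φ.continuous.continuousAt.comp h1)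
    exact h2.tendsto.mono_left nhdsWithin_le_nhds
  have hlim := tendsto_nhds_unique (hc1.congr' hev) hc2
  rw [sub_self, zero_pow two_ne_zero, zero_mul, huz] at hlim
  exact (mul_eq_zero.1 hlim).resolve_right hg0

end RankOnePerturbation

/-! ### The spectral splitting -/

section Splitting

open Polynomial

theorem mapsTo_range_of_commute {E : Type*} [AddCommGroup E] [Module ℂ E] {f g : Module.End ℂ E}
    (h : Commute f g) {x : E} (hx : x ∈ LinearMap.range g) : f x ∈ LinearMap.range g := by
  obtain ⟨y, rfl⟩ := hx
  exact ⟨f y, (LinearMap.congr_fun h y).symm⟩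

/-- The operator `∏ i, (f - lam i) ^ p i`. -/
def subPowProd {E : Type*} [AddCommGroup E] [Module ℂ E] (f : Module.End ℂ E) {m : ℕ}
    (lam : Fin m → ℂ) (p : Fin m → ℕ) : Module.End ℂ E :=
  aeval f (∏ i, (X - C (lam i)) ^ p i)

section Algebra

variable {E : Type*} [AddCommGroup E] [Module ℂ E] {f : Module.End ℂ E} {m : ℕ}
  {lam : Fin m → ℂ} {p : Fin m → ℕ}

theorem ker_subPowProd (hlam : Function.Injective lam) :
    LinearMap.ker (subPowProd f lam p) =
      ⨆ i, LinearMap.ker ((f - lam i • LinearMap.id) ^ p i) := by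
  rw [subPowProd, ker_aeval_prod_X_sub_C_pow f hlam p Finset.univ]
  simp

theorem commute_sub_subPowProd (z : ℂ) : Commute (f - z • LinearMap.id) (subPowProd f lam p) := by
  have h := aeval_X_sub_C_pow f z 1
  rw [pow_one, pow_one] at h
  rw [← h, subPowProd, commute_iff_eq, ← map_mul, ← map_mul, mul_comm]

theorem exists_subPowProd_eq_sub_mul {i : Fin m} (hp : 1 ≤ p i) :
    ∃ g : Module.End ℂ E, Commute g (subPowProd f lam p) ∧
      subPowProd f lam p = (f - lam i • LinearMap.id) * g := by
  have hdvd : (X - C (lam i)) ^ 1 ∣ ∏ i, (X - C (lam i)) ^ p i :=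
    (pow_dvd_pow _ hp).trans (Finset.dvd_prod_of_mem _ (Finset.mem_univ i))
  obtain ⟨q, hq⟩ := hdvd
  refine ⟨aeval f q, ?_, ?_⟩
  · rw [subPowProd, commute_iff_eq, ← map_mul, ← map_mul, mul_comm]
  · rw [subPowProd, hq, map_mul, aeval_X_sub_C_pow, pow_one]

theorem isFredholmIndexZero_subPowProd
    (h : ∀ i, IsFredholmIndexZero (f - lam i • LinearMap.id)) :
    IsFredholmIndexZero (subPowProd f lam p) := by
  have hpow : ∀ i (n : ℕ), IsFredholmIndexZero (aeval f ((X - C (lam i)) ^ n)) := by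
    intro i n
    rw [aeval_X_sub_C_pow]
    induction n with
    | zero => exact IsFredholmIndexZero.one
    | succ n ih => exact ih.mul (h i)
  exact Finset.prod_induction _ (fun q : ℂ[X] => IsFredholmIndexZero (aeval f q))
    (fun q₁ q₂ h₁ h₂ => by rw [map_mul]; exact h₁.mul h₂)
    (by rw [map_one]; exact IsFredholmIndexZero.one) fun i _ => hpow i (p i)

/-- If the kernels of the powers of each Fredholm operator `f - lam i` are stable from the exponent
`p i` on, then `B = ∏ i, (f - lam i) ^ p i` satisfies `ker (B ^ 2) = ker B`. -/
theorem isCompl_ker_range_subPowProd (hlam : Function.Injective lam)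
    (h : ∀ i, IsFredholmIndexZero (f - lam i • LinearMap.id))
    (hp : ∀ i, LinearMap.ker ((f - lam i • LinearMap.id) ^ p i) =
      LinearMap.ker ((f - lam i • LinearMap.id) ^ (p i + 1))) :
    IsCompl (LinearMap.ker (subPowProd f lam p)) (LinearMap.range (subPowProd f lam p)) := by
  have h2 : LinearMap.ker (subPowProd f lam p * subPowProd f lam p) =
      LinearMap.ker (subPowProd f lam p) := by
    have hqq : (∏ i, (X - C (lam i)) ^ p i) * ∏ i, (X - C (lam i)) ^ p i =
        ∏ i, (X - C (lam i)) ^ (p i * 2) := by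
      rw [← Finset.prod_mul_distrib]
      exact Finset.prod_congr rfl fun i _ => by ring
    rw [subPowProd, ← map_mul, hqq, ker_aeval_prod_X_sub_C_pow f hlam _ Finset.univ,
      ker_aeval_prod_X_sub_C_pow f hlam _ Finset.univ]
    exact iSup_congr fun i => iSup_congr fun _ => ker_pow_mul_two_of_ker_pow_succ (hp i)
  refine (isFredholmIndexZero_subPowProd h).isCompl ?_
  rw [Submodule.disjoint_def]
  rintro _ hx ⟨y, rfl⟩
  have hy : y ∈ LinearMap.ker (subPowProd f lam p * subPowProd f lam p) := hx
  rwa [h2] at hy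

theorem ker_sub_le_ker_sub_pow {i : Fin m} (hp : 1 ≤ p i) :
    LinearMap.ker (f - lam i • LinearMap.id) ≤
      LinearMap.ker ((f - lam i • LinearMap.id) ^ p i) := by
  obtain ⟨k, hk⟩ : ∃ k, p i = k + 1 := ⟨p i - 1, by omega⟩
  intro x hx
  rw [hk, LinearMap.mem_ker, pow_succ, Module.End.mul_apply, LinearMap.mem_ker.1 hx, map_zero]

/-- Suppose that `B = ∏ i, (f - lam i) ^ p i` has complementary kernel and range.  Then `f - z` is
bijective on the range of `B` if `f - z` is bijective or `z` is one of the `lam i`: in the second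
case, `B` is bijective on its range and factors through `f - z`. -/
theorem bijOn_sub_range_subPowProd (hlam : Function.Injective lam) (hp1 : ∀ i, 1 ≤ p i)
    (hB : IsCompl (LinearMap.ker (subPowProd f lam p)) (LinearMap.range (subPowProd f lam p)))
    {z : ℂ} (hz : (∃ i, lam i = z) ∨
      Function.Bijective (f - z • LinearMap.id : Module.End ℂ E)) :
    (∀ x ∈ LinearMap.range (subPowProd f lam p),
      (f - z • LinearMap.id : Module.End ℂ E) x = 0 → x = 0) ∧
    ∀ y ∈ LinearMap.range (subPowProd f lam p), ∃ x ∈ LinearMap.range (subPowProd f lam p),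
      (f - z • LinearMap.id : Module.End ℂ E) x = y := by
  rcases hz with ⟨i, rfl⟩ | hbij
  · refine ⟨fun x hx hx0 => ?_, ?_⟩
    · refine Submodule.disjoint_def.1 hB.disjoint x ?_ hx
      rw [ker_subPowProd hlam]
      exact Submodule.mem_iSup_of_mem i (ker_sub_le_ker_sub_pow (hp1 i) hx0)
    · rintro _ ⟨y, rfl⟩
      obtain ⟨k, hk, y', hy', rfl⟩ :=
        Submodule.mem_sup.1 (hB.sup_eq_top ▸ Submodule.mem_top (x := y))
      obtain ⟨g, hgB, hg⟩ := exists_subPowProd_eq_sub_mul (f := f) (lam := lam) (hp1 i)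
      refine ⟨g y', mapsTo_range_of_commute hgB hy', ?_⟩
      rw [map_add, LinearMap.mem_ker.1 hk, zero_add]
      exact (LinearMap.congr_fun hg y').symm
  · refine ⟨fun x _ hx => hbij.1 (hx.trans (map_zero _).symm), ?_⟩
    rintro _ ⟨y, rfl⟩
    obtain ⟨x, rfl⟩ := hbij.2 y
    exact ⟨subPowProd f lam p x, ⟨x, rfl⟩, LinearMap.congr_fun (commute_sub_subPowProd z) x⟩

end Algebra

theorem exists_norm_pow_le_of_bijective {F : Type*} [NormedAddCommGroup F] [NormedSpace ℂ F]
    [CompleteSpace F] (A : F →L[ℂ] F) {r : ℝ} (hr : 0 < r)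
    (h : ∀ z : ℂ, r ≤ ‖z‖ → Function.Bijective fun x => A x - z • x) :
    ∃ K : ℝ, ∀ n : ℕ, ‖A ^ n‖ ≤ K * r ^ n := by
  refine exists_norm_pow_le_of_spectrum A hr fun z hz => ?_
  by_contra! hzr
  refine hz ?_
  rw [spectrum.mem_resolventSet_iff, ← IsUnit.neg_iff, neg_sub,
    ContinuousLinearMap.isUnit_iff_bijective]
  exact h z hzr

/-- Let `H` be a closed invariant subspace of `L` on which `L - z` is bijective for all `z` of
modulus at least `r`.  Then `‖L ^ n‖ = O(r ^ n)` on `H`. -/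
theorem exists_norm_pow_apply_le_of_bijOn {E : Type*} [NormedAddCommGroup E] [NormedSpace ℂ E]
    [CompleteSpace E] {L : E →L[ℂ] E} {H : Submodule ℂ E} (hH : IsClosed (H : Set E))
    (hinv : ∀ h ∈ H, L h ∈ H) {r : ℝ} (hr : 0 < r)
    (hbij : ∀ z : ℂ, r ≤ ‖z‖ → (∀ x ∈ H, L x - z • x = 0 → x = 0) ∧
      ∀ y ∈ H, ∃ x ∈ H, L x - z • x = y) :
    ∃ K : ℝ, ∀ n : ℕ, ∀ h ∈ H, ‖h‖ ≤ 1 → ‖(L ^ n) h‖ ≤ K * r ^ n := by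
  have : CompleteSpace H := hH.completeSpace_coe
  obtain ⟨LH, hLH⟩ : ∃ LH : H →L[ℂ] H, ∀ h : H, (LH h : E) = L h :=
    ⟨(L ∘L H.subtypeL).codRestrict H fun h => hinv h h.2, fun _ => rfl⟩
  have hcoe : ∀ (z : ℂ) (h : H), ((LH h - z • h : H) : E) = L h - z • (h : E) := fun z h => by
    rw [Submodule.coe_sub, hLH, Submodule.coe_smul]
  obtain ⟨K, hK⟩ := exists_norm_pow_le_of_bijective LH hr fun z hzr => by
    constructor
    · intro x y hxy
      have h1 : L (x - y : H) - z • ((x - y : H) : E) = 0 := by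
        rw [← hcoe, map_sub, smul_sub, sub_sub_sub_comm, sub_eq_zero.2 hxy, Submodule.coe_zero]
      exact sub_eq_zero.1 (Subtype.ext ((hbij z hzr).1 _ (x - y).2 h1))
    · rintro ⟨y, hy⟩
      obtain ⟨x, hx, hxy⟩ := (hbij z hzr).2 y hy
      exact ⟨⟨x, hx⟩, Subtype.ext ((hcoe z ⟨x, hx⟩).trans hxy)⟩
  have hLHpow : ∀ (n : ℕ) (h : H), (((LH ^ n) h : H) : E) = (L ^ n) h := by
    intro n
    induction n with
    | zero => intro h; rfl
    | succ n ih =>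
      intro h
      rw [pow_succ, pow_succ, mul_apply_eq_comp, mul_apply_eq_comp, ih,
        hLH]
  refine ⟨K, fun n h hh h1 => ?_⟩
  rw [← hLHpow n ⟨h, hh⟩]
  calc ‖(LH ^ n) ⟨h, hh⟩‖ ≤ ‖LH ^ n‖ * ‖(⟨h, hh⟩ : H)‖ := (LH ^ n).le_opNorm _
    _ ≤ ‖LH ^ n‖ * 1 := by gcongr; exact h1
    _ ≤ K * r ^ n := by rw [mul_one]; exact hK n

/-- Polynomials in `L` as a bounded operator and as a linear map agree; so `subPowProd L lam p` is
bounded. -/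
theorem toLinearMap_aeval {E : Type*} [NormedAddCommGroup E] [NormedSpace ℂ E]
    (L : E →L[ℂ] E) (q : ℂ[X]) :
    ((aeval L q : E →L[ℂ] E) : E →ₗ[ℂ] E) = aeval (L : Module.End ℂ E) q :=
  (Polynomial.aeval_algHom_apply
    (AlgHom.ofLinearMap (ContinuousLinearMap.coeLM ℂ : (E →L[ℂ] E) →ₗ[ℂ] Module.End ℂ E) rfl
      fun _ _ => rfl) L q).symm

/-- A rank-one perturbation of an operator with spectrum in `‖z‖ ≤ a` splits at every level `r > a`,
provided that it has a spectral value of modulus at least `r`. -/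
theorem hasSpectralSplitting_of_rankOne {E : Type*} [NormedAddCommGroup E] [NormedSpace ℂ E]
    [CompleteSpace E] {L T : E →L[ℂ] E} {φ : E →L[ℂ] ℂ} {s : E} {a r : ℝ} (ha0 : 0 ≤ a)
    (ha : ∀ z : ℂ, a < ‖z‖ → z ∈ resolventSet ℂ T) (hL : ∀ x, L x = T x + φ x • s) (har : a < r)
    (hex : ∃ z ∈ spectrum ℂ L, r ≤ ‖z‖) : HasSpectralSplitting L r := by
  have hr0 : 0 < r := ha0.trans_lt har
  set f : Module.End ℂ E := (L : E →ₗ[ℂ] E) with hf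
  -- An enumeration of the spectral values of modulus at least `r`.
  have hfin := finite_spectrum_of_rankOne ha0 ha hL har
  have : Finite {z ∈ spectrum ℂ L | r ≤ ‖z‖} := hfin
  obtain ⟨m, ⟨e⟩⟩ := Finite.exists_equiv_fin {z ∈ spectrum ℂ L | r ≤ ‖z‖}
  set lam : Fin m → ℂ := fun i => (e.symm i : ℂ) with hlam
  have hlam_inj : Function.Injective lam := Subtype.val_injective.comp e.symm.injective
  have hlam_mem : ∀ i, lam i ∈ spectrum ℂ L ∧ r ≤ ‖lam i‖ := fun i => (e.symm i).2
  have hlam_surj : ∀ z ∈ spectrum ℂ L, r ≤ ‖z‖ → ∃ i, lam i = z := fun z hz hzr =>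
    ⟨e ⟨z, hz, hzr⟩, by simp [hlam]⟩
  have hlam_a : ∀ i, a < ‖lam i‖ := fun i => har.trans_le (hlam_mem i).2
  choose p hp1 hp using fun i => exists_ker_pow_eq_ker_pow_succ ha0 ha hL (hlam_a i)
  have hm : 1 ≤ m := by
    obtain ⟨z, hz, hzr⟩ := hex
    exact Fin.pos (hlam_surj z hz hzr).choose
  set B := subPowProd f lam p with hB
  have hfred : ∀ i, IsFredholmIndexZero (f - lam i • LinearMap.id) := fun i =>
    isFredholmIndexZero_sub hL (ha _ (hlam_a i))
  have hBfin : FiniteDimensional ℂ (LinearMap.ker B) :=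
    (isFredholmIndexZero_subPowProd hfred).finite_ker
  have hcompl : IsCompl (LinearMap.ker B) (LinearMap.range B) :=
    isCompl_ker_range_subPowProd hlam_inj hfred hp
  have hkerB : LinearMap.ker B = ⨆ i, charKer L (lam i) (p i) := ker_subPowProd hlam_inj
  have hHcl : IsClosed (LinearMap.range B : Set E) := by
    have hBc : ((aeval L (∏ i, (X - C (lam i)) ^ p i) : E →L[ℂ] E) : E →ₗ[ℂ] E) = B :=
      toLinearMap_aeval L _
    rw [← hBc] at hBfin hcompl ⊢
    exact isClosed_range_of_isCompl_ker _ hcompl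
  have hfB : Commute f B := by
    have h := commute_sub_subPowProd (f := f) (lam := lam) (p := p) 0
    rwa [zero_smul, sub_zero] at h
  have hinv : ∀ h ∈ LinearMap.range B, L h ∈ LinearMap.range B := fun h hh =>
    mapsTo_range_of_commute hfB hh
  obtain ⟨K, hK⟩ := exists_norm_pow_apply_le_of_bijOn hHcl hinv hr0 fun z hzr => by
    have hz := ha z (har.trans_le hzr)
    refine bijOn_sub_range_subPowProd hlam_inj hp1 hcompl ?_
    by_cases hzL : z ∈ spectrum ℂ L
    · exact Or.inl (hlam_surj z hzL hzr)
    · exact Or.inr (bijective_sub_of_rankOneDet_ne_zero hL hz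
        fun h0 => hzL ((mem_spectrum_iff_rankOneDet_eq_zero hL hz).2 h0))
  refine ⟨m, lam, p, LinearMap.range B, hm, hp1, ?_, fun i => (hlam_mem i).2, fun i => ?_, hHcl,
    hinv, K, hK⟩
  · exact isInternal_option_of_isCompl (iSupIndep_ker_sub_pow f hlam_inj p) (hkerB ▸ hcompl)
  · have hle : charKer L (lam i) (p i) ≤ LinearMap.ker B :=
      hkerB ▸ le_iSup (fun i => charKer L (lam i) (p i)) i
    have hfd : FiniteDimensional ℂ (charKer L (lam i) (p i)) :=
      Submodule.finiteDimensional_of_le hle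
    refine ⟨hfd, ?_⟩
    rw [Submodule.one_le_finrank_iff]
    have hdet := (mem_spectrum_iff_rankOneDet_eq_zero hL (ha _ (hlam_a i))).1 (hlam_mem i).1
    obtain ⟨hu, hφu⟩ := apply_resolvent_of_rankOneDet_eq_zero hL (ha _ (hlam_a i)) hdet
    intro hbot
    have hmem : resolvent T (lam i) s ∈ charKer L (lam i) (p i) :=
      ker_sub_le_ker_sub_pow (hp1 i) (sub_eq_zero.2 hu)
    rw [hbot, Submodule.mem_bot] at hmem
    rw [hmem, map_zero] at hφu
    exact zero_ne_one hφu

end Splitting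

/-! ### The essential spectral radius of a rank-one perturbation -/

section EssentialRadius

variable {E : Type*} [NormedAddCommGroup E] [NormedSpace ℂ E] {L T : E →L[ℂ] E}
  {φ : E →L[ℂ] ℂ} {s : E} {C α : ℝ}

/-- A bound `‖T ^ n‖ ≤ C α ^ n` confines the spectrum of `T` to `‖z‖ ≤ α`. -/
theorem mem_resolventSet_of_norm_pow_le [CompleteSpace E] (hα : 0 ≤ α)
    (hT : ∀ n : ℕ, ‖T ^ n‖ ≤ C * α ^ n) {z : ℂ} (hz : α < ‖z‖) : z ∈ resolventSet ℂ T := by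
  by_contra hzs
  have hz0 : 0 < ‖z‖ := hα.trans_lt hz
  set D : ℝ := C * ‖(1 : E →L[ℂ] E)‖
  have h1 : ∀ n : ℕ, ‖z‖ ^ n ≤ D * α ^ n := fun n => by
    have h := spectrum.norm_le_norm_mul_of_mem (spectrum.pow_mem_pow T n hzs)
    rw [norm_pow] at h
    calc ‖z‖ ^ n ≤ ‖T ^ n‖ * ‖(1 : E →L[ℂ] E)‖ := h
      _ ≤ C * α ^ n * ‖(1 : E →L[ℂ] E)‖ := by gcongr; exact hT n
      _ = D * α ^ n := by ring
  have h2 : Tendsto (fun n : ℕ => D * (α / ‖z‖) ^ n) atTop (𝓝 (D * 0)) :=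
    (tendsto_pow_atTop_nhds_zero_of_lt_one (by positivity) ((div_lt_one hz0).2 hz)).const_mul D
  have h3 : (1 : ℝ) ≤ D * 0 := ge_of_tendsto' h2 fun n => by
    rw [div_pow, ← mul_div_assoc, one_le_div (pow_pos hz0 n)]
    exact h1 n
  linarith

theorem isCompactOperator_pow_sub_pow (hL : ∀ x, L x = T x + φ x • s) (n : ℕ) :
    IsCompactOperator (L ^ n - T ^ n) := by
  induction n with
  | zero => simpa using! isCompactOperator_zero
  | succ n ih =>
    have hrank : IsCompactOperator (φ.smulRight s) := by
      have h : IsCompactOperator (ContinuousLinearMap.toSpanSingleton ℂ s) :=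
        isCompactOperator_of_locallyCompactSpace_rng _
      exact h.comp_clm φ
    have hLT : L = T + φ.smulRight s := by ext x; simp [hL]
    have h : L ^ (n + 1) - T ^ (n + 1) = L * (L ^ n - T ^ n) + φ.smulRight s * T ^ n := by
      rw [mul_sub, ← pow_succ', pow_succ' T, hLT, add_mul]
      abel
    rw [h]
    exact (ih.clm_comp L).add (hrank.comp_clm (T ^ n))

theorem essSpectralRadius_le_of_rankOne (hα : 0 ≤ α) (hC : 0 < C)
    (hT : ∀ n : ℕ, ‖T ^ n‖ ≤ C * α ^ n) (hL : ∀ x, L x = T x + φ x • s) :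
    essSpectralRadius L ≤ α := by
  have hinf0 : ∀ n : ℕ, 0 ≤ ⨅ K : {K : E →L[ℂ] E // IsCompactOperator K}, ‖L ^ n - K.1‖ :=
    fun n => Real.iInf_nonneg fun K => norm_nonneg _
  have hle : ∀ n : ℕ, (⨅ K : {K : E →L[ℂ] E // IsCompactOperator K}, ‖L ^ n - K.1‖) ≤
      C * α ^ n := fun n => by
    refine (ciInf_le ⟨0, ?_⟩ ⟨L ^ n - T ^ n, isCompactOperator_pow_sub_pow hL n⟩).trans ?_
    · rintro _ ⟨K, rfl⟩
      exact norm_nonneg _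
    · simpa using hT n
  have hlim : Tendsto (fun n : ℕ => C ^ (1 / (n : ℝ)) * α) atTop (𝓝 α) := by
    have h1 : Tendsto (fun n : ℕ => 1 / (n : ℝ)) atTop (𝓝 0) := tendsto_one_div_atTop_nhds_zero_nat
    have h2 := ((tendsto_const_nhds (x := C)).rpow h1 (Or.inl hC.ne')).mul_const α
    simpa using h2
  rw [← hlim.limsup_eq]
  refine limsup_le_limsup ?_ ?_ hlim.isBoundedUnder_le
  · filter_upwards [eventually_gt_atTop 0] with n hn
    calc _ ≤ (C * α ^ n) ^ (1 / (n : ℝ)) :=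
          Real.rpow_le_rpow (hinf0 n) (hle n) (by positivity)
      _ = C ^ (1 / (n : ℝ)) * α := by
          rw [Real.mul_rpow hC.le (pow_nonneg hα n), one_div,
            Real.pow_rpow_inv_natCast hα hn.ne']
  · exact (isBoundedUnder_of ⟨0, fun n => Real.rpow_nonneg (hinf0 n) _⟩ :
      IsBoundedUnder (· ≥ ·) atTop _).isCoboundedUnder_le

variable [CompleteSpace E]

theorem hasSpectralSplitting_of_norm_pow_le (hα : 0 ≤ α)
    (hT : ∀ n : ℕ, ‖T ^ n‖ ≤ C * α ^ n) (hL : ∀ x, L x = T x + φ x • s)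
    (h1 : (1 : ℂ) ∈ spectrum ℂ L) {r : ℝ} (hαr : α < r) (hr : r < 1) :
    0 < r ∧ ENNReal.ofReal r < spectralRadius ℂ L ∧ HasSpectralSplitting L r := by
  refine ⟨hα.trans_lt hαr, ?_, hasSpectralSplitting_of_rankOne hα
    (fun z => mem_resolventSet_of_norm_pow_le hα hT) hL hαr ⟨1, h1, by simpa using hr.le⟩⟩
  have h2 : ((‖(1 : ℂ)‖₊ : ℝ≥0∞)) ≤ spectralRadius ℂ L :=
    le_iSup₂ (f := fun k (_ : k ∈ spectrum ℂ L) => (‖k‖₊ : ℝ≥0∞)) 1 h1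
  refine lt_of_lt_of_le ?_ h2
  simpa using hr

theorem isQuasiCompact_of_rankOne (hα : 0 ≤ α) (hα1 : α < 1)
    (hT : ∀ n : ℕ, ‖T ^ n‖ ≤ C * α ^ n) (hL : ∀ x, L x = T x + φ x • s)
    (h1 : (1 : ℂ) ∈ spectrum ℂ L) : IsQuasiCompact L := by
  obtain ⟨r, hαr, hr⟩ := exists_between hα1
  exact ⟨r, hasSpectralSplitting_of_norm_pow_le hα hT hL h1 hαr hr⟩

theorem splittingRadius_le_of_rankOne (hα : 0 ≤ α) (hα1 : α < 1)
    (hT : ∀ n : ℕ, ‖T ^ n‖ ≤ C * α ^ n) (hL : ∀ x, L x = T x + φ x • s)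
    (h1 : (1 : ℂ) ∈ spectrum ℂ L) : splittingRadius L ≤ α := by
  refine le_of_forall_gt_imp_ge_of_dense fun r hαr => ?_
  obtain ⟨r', hαr', hr'⟩ := exists_between (lt_min hαr hα1)
  have hbdd : BddBelow {r₀ : ℝ | 0 < r₀ ∧ ENNReal.ofReal r₀ < spectralRadius ℂ L ∧
      HasSpectralSplitting L r₀} := ⟨0, fun x hx => hx.1.le⟩
  exact (csInf_le hbdd (hasSpectralSplitting_of_norm_pow_le hα hT hL h1 hαr'
    (hr'.trans_le (min_le_right _ _)))).trans (hr'.le.trans (min_le_left _ _))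

end EssentialRadius

/-! ### Drift and minorization for kernels on the weighted space -/

section DriftKernel

variable {X : Type*} [MeasurableSpace X] {V : X → ℝ} {hV : ∀ x, 1 ≤ V x}

theorem BV.integrable_of_integrable_weight {μ : Measure X} (hμ : Integrable V μ) (f : BV V hV) :
    Integrable (fun x => f x) μ :=
  (hμ.const_mul ‖f‖).mono' f.2.1.aestronglyMeasurable (ae_of_all _ f.apply_le)

/-- Integration against a measure that integrates `V`, as a bounded functional on `B_V`. -/
def BV.integralCLM {μ : Measure X} (hμ : Integrable V μ) : BV V hV →L[ℂ] ℂ :=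
  LinearMap.mkContinuous
    { toFun := fun f => ∫ x, f x ∂μ
      map_add' := fun f g => integral_add (f.integrable_of_integrable_weight hμ)
        (g.integrable_of_integrable_weight hμ)
      map_smul' := fun c f => integral_const_mul c (fun x => f x) }
    (∫ x, V x ∂μ) fun f => by
      rw [mul_comm, ← integral_const_mul]
      exact norm_integral_le_of_norm_le (hμ.const_mul ‖f‖) (ae_of_all _ f.apply_le)

/-- The indicator function of a measurable set, as an element of `B_V`. -/
def BV.indicator {A : Set X} (hA : MeasurableSet A) : BV V hV :=
  BV.mk (A.indicator fun _ => 1) (measurable_const.indicator hA) 1 fun x => by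
    rw [one_mul]
    refine le_trans ?_ (hV x)
    by_cases hx : x ∈ A <;> simp [hx]

/-- If `T` carries functions bounded by the weight `W n` to functions bounded by `W (n + 1)`, then
`T ^ n` carries functions bounded by `V` to functions bounded by `W n`. -/
theorem BV.norm_pow_le {T : BV V hV →L[ℂ] BV V hV} {W : ℕ → X → ℝ} {D : ℕ → ℝ}
    (h0 : ∀ x, V x ≤ W 0 x) (hD : ∀ n, 0 ≤ D n) (hWD : ∀ n x, W n x ≤ D n * V x)
    (hT : ∀ n (f : BV V hV) (k : ℝ), 0 ≤ k → (∀ x, ‖f x‖ ≤ k * W n x) →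
      ∀ x, ‖T f x‖ ≤ k * W (n + 1) x) (n : ℕ) : ‖T ^ n‖ ≤ D n := by
  refine ContinuousLinearMap.opNorm_le_bound _ (hD n) fun f => ?_
  have h : ∀ x, ‖(T ^ n) f x‖ ≤ ‖f‖ * W n x := by
    induction n with
    | zero =>
      intro x
      exact (f.apply_le x).trans (mul_le_mul_of_nonneg_left (h0 x) (norm_nonneg f))
    | succ n ih =>
      rw [pow_succ', mul_apply_eq_comp]
      exact hT n _ _ (norm_nonneg f) ih
  refine BV.norm_le (mul_nonneg (hD n) (norm_nonneg f)) fun x => (h x).trans ?_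
  calc ‖f‖ * W n x ≤ ‖f‖ * (D n * V x) := mul_le_mul_of_nonneg_left (hWD n x) (norm_nonneg f)
    _ = D n * ‖f‖ * V x := by ring

variable {P : Kernel X X} [IsMarkovKernel P] {ϱ M : ℝ}

theorem integrable_weight_of_lintegral_le (hVm : Measurable V) (hV : ∀ x, 1 ≤ V x)
    {μ : Measure X} {c : ℝ} (h : ∫⁻ y, ENNReal.ofReal (V y) ∂μ ≤ ENNReal.ofReal c) :
    Integrable V μ := by
  refine ⟨hVm.aestronglyMeasurable, ?_⟩
  rw [hasFiniteIntegral_iff_ofReal (ae_of_all _ fun x => zero_le_one.trans (hV x))]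
  exact h.trans_lt ENNReal.ofReal_lt_top

theorem integral_weight_le_of_lintegral_le (hVm : Measurable V) (hV : ∀ x, 1 ≤ V x)
    {μ : Measure X} {c : ℝ} (hc : 0 ≤ c)
    (h : ∫⁻ y, ENNReal.ofReal (V y) ∂μ ≤ ENNReal.ofReal c) : ∫ y, V y ∂μ ≤ c := by
  rw [integral_eq_lintegral_of_nonneg_ae (ae_of_all _ fun x => zero_le_one.trans (hV x))
    hVm.aestronglyMeasurable]
  exact ENNReal.toReal_le_of_le_ofReal hc h

/-- `P V ≤ ϱ V` cannot hold everywhere: with `i = inf V ≥ 1`, it would give `i ≤ P V ≤ ϱ V`, hence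
`i ≤ ϱ i`. -/
theorem exists_lt_integral_weight [Nonempty X] (hV : ∀ x, 1 ≤ V x)
    (hint : ∀ x, Integrable V (P x)) (hϱ₀ : 0 < ϱ) (hϱ₁ : ϱ < 1) :
    ∃ x, ϱ * V x < ∫ y, V y ∂(P x) := by
  by_contra! h
  set i := ⨅ x, V x with hi
  have hbdd : BddBelow (Set.range V) := ⟨1, by rintro _ ⟨x, rfl⟩; exact hV x⟩
  have hi1 : 1 ≤ i := le_ciInf hV
  have h1 : ∀ x, i / ϱ ≤ V x := fun x => by
    have h2 : i ≤ ∫ y, V y ∂(P x) := by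
      have h3 := integral_mono (μ := P x) (integrable_const i) (hint x) fun y => ciInf_le hbdd y
      simpa using h3
    rw [div_le_iff₀' hϱ₀]
    exact h2.trans (h x)
  have h2 : i / ϱ ≤ i := le_ciInf h1
  rw [div_le_iff₀ hϱ₀] at h2
  nlinarith

/-- Iterating the drift inequality gives `P ^ n V ≤ ϱ ^ n V + M (1 + ϱ + ⋯ + ϱ ^ (n - 1))`. -/
theorem isPowerBounded_kernelOp (hV : ∀ x, 1 ≤ V x)
    (hPV : ∃ C : ℝ, ∀ x, ∫⁻ y, ENNReal.ofReal (V y) ∂(P x) ≤ ENNReal.ofReal (C * V x))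
    (hint : ∀ x, Integrable V (P x)) (hϱ₀ : 0 < ϱ) (hϱ₁ : ϱ < 1) (hM : 0 < M)
    (hle : ∀ x, ∫ y, V y ∂(P x) ≤ ϱ * V x + M) :
    IsPowerBounded (kernelOp V hV P hPV) := by
  have hgeom : ∀ n : ℕ, M * ∑ i ∈ Finset.range n, ϱ ^ i ≤ M / (1 - ϱ) := fun n => by
    rw [div_eq_mul_inv]
    gcongr
    rw [← tsum_geometric_of_lt_one hϱ₀.le hϱ₁]
    exact (summable_geometric_of_lt_one hϱ₀.le hϱ₁).sum_le_tsum _ fun i _ => pow_nonneg hϱ₀.le i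
  have hgeom0 : ∀ n : ℕ, 0 ≤ M * ∑ i ∈ Finset.range n, ϱ ^ i := fun n => by positivity
  refine ⟨1 + M / (1 - ϱ), BV.norm_pow_le (D := fun _ => 1 + M / (1 - ϱ))
    (W := fun n x => ϱ ^ n * V x + M * ∑ i ∈ Finset.range n, ϱ ^ i) (fun x => by simp)
    (fun n => ?_) (fun n x => ?_) fun n f k hk hf x => ?_⟩
  · have := (hgeom0 0).trans (hgeom 0)
    linarith
  · have h1 : ϱ ^ n ≤ 1 := pow_le_one₀ hϱ₀.le hϱ₁.le
    have h2 := (hgeom0 n).trans (hgeom n)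
    nlinarith [hV x, hgeom n]
  · rw [kernelOp_apply]
    set b := M * ∑ i ∈ Finset.range n, ϱ ^ i with hb
    have hW : Integrable (fun y => k * (ϱ ^ n * V y + b)) (P x) :=
      (((hint x).const_mul _).add (integrable_const b)).const_mul k
    refine (norm_integral_le_of_norm_le hW (ae_of_all _ hf)).trans ?_
    rw [integral_const_mul, integral_add ((hint x).const_mul _) (integrable_const b),
      integral_const_mul, integral_const, probReal_univ, one_smul]
    refine mul_le_mul_of_nonneg_left ?_ hk
    rw [Finset.sum_range_succ, mul_add, ← hb, pow_succ]
    nlinarith [hle x, pow_pos hϱ₀ n]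

theorem one_mem_spectrum_kernelOp [Nonempty X] (hV : ∀ x, 1 ≤ V x)
    (hPV : ∃ C : ℝ, ∀ x, ∫⁻ y, ENNReal.ofReal (V y) ∂(P x) ≤ ENNReal.ofReal (C * V x)) :
    (1 : ℂ) ∈ spectrum ℂ (kernelOp V hV P hPV) := by
  rw [ContinuousLinearMap.spectrum_eq]
  refine Module.End.HasEigenvalue.mem_spectrum
    (Module.End.hasEigenvalue_of_hasEigenvector (x := BV.indicator MeasurableSet.univ) ⟨?_, ?_⟩)
  · rw [Module.End.mem_eigenspace_iff, one_smul]
    refine Subtype.ext (funext fun x => ?_)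
    refine (kernelOp_apply P hPV _ x).trans ?_
    simp [BV.indicator, BV.mk]
  · intro h
    obtain ⟨x⟩ := ‹Nonempty X›
    have h1 := congrFun (congrArg Subtype.val h) x
    have h2 : (1 : ℂ) = 0 := by
      rw [← Set.indicator_of_mem (Set.mem_univ x) fun _ => (1 : ℂ)]
      exact h1
    exact one_ne_zero h2

/-- The residual operator `f ↦ P f - ν(f) 1_A` on `B_V`. -/
def residualOp (V : X → ℝ) (hV : ∀ x, 1 ≤ V x) (P : Kernel X X) [IsMarkovKernel P]
    (hPV : ∃ C : ℝ, ∀ x, ∫⁻ y, ENNReal.ofReal (V y) ∂(P x) ≤ ENNReal.ofReal (C * V x))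
    {ν : Measure X} (hν : Integrable V ν) {A : Set X} (hA : MeasurableSet A) :
    BV V hV →L[ℂ] BV V hV :=
  kernelOp V hV P hPV - (BV.integralCLM hν).smulRight (BV.indicator hA)

theorem residualOp_apply (hV : ∀ x, 1 ≤ V x)
    (hPV : ∃ C : ℝ, ∀ x, ∫⁻ y, ENNReal.ofReal (V y) ∂(P x) ≤ ENNReal.ofReal (C * V x))
    {ν : Measure X} (hν : Integrable V ν) {A : Set X} (hA : MeasurableSet A) (f : BV V hV)
    (x : X) : residualOp V hV P hPV hν hA f x =
      ∫ y, f y ∂(P x) - (∫ y, f y ∂ν) * A.indicator (fun _ => 1) x := rfl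

/-- If `ν ≤ P x` for `x ∈ A`, the residual operator is an integral operator with nonnegative kernel
`P x - 1_A(x) ν`, so the pointwise bound of a function by a weight carries over to its image. -/
theorem norm_residualOp_apply_le (hV : ∀ x, 1 ≤ V x)
    (hPV : ∃ C : ℝ, ∀ x, ∫⁻ y, ENNReal.ofReal (V y) ∂(P x) ≤ ENNReal.ofReal (C * V x))
    {ν : Measure X} [IsFiniteMeasure ν] (hν : Integrable V ν) {A : Set X} (hA : MeasurableSet A)
    (hνP : ∀ x ∈ A, ν ≤ P x) {W : X → ℝ} (hWP : ∀ x, Integrable W (P x)) (f : BV V hV)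
    (hf : ∀ x, ‖f x‖ ≤ W x) (x : X) :
    ‖residualOp V hV P hPV hν hA f x‖ ≤
      ∫ y, W y ∂(P x) - (∫ y, W y ∂ν) * A.indicator (fun _ => 1) x := by
  rw [residualOp_apply]
  by_cases hx : x ∈ A
  · have hsub : P x - ν + ν = P x := Measure.sub_add_cancel_of_le (hνP x hx)
    have hsplit : ∀ {F : Type} [NormedAddCommGroup F] [NormedSpace ℝ F] {g : X → F},
        Integrable g (P x) → ∫ y, g y ∂(P x) - ∫ y, g y ∂ν = ∫ y, g y ∂(P x - ν) := by
      intro F _ _ g hg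
      have h := integral_add_measure (hg.mono_measure (Measure.sub_le (μ := P x) (ν := ν)))
        (hg.mono_measure (hνP x hx))
      rw [hsub] at h
      rw [h, add_sub_cancel_right]
    simp only [Set.indicator_of_mem hx, mul_one]
    rw [hsplit (f.integrable P hPV x), hsplit (hWP x)]
    exact norm_integral_le_of_norm_le ((hWP x).mono_measure Measure.sub_le) (ae_of_all _ hf)
  · simp only [Set.indicator_of_notMem hx, mul_zero, sub_zero]
    exact norm_integral_le_of_norm_le (hWP x) (ae_of_all _ hf)

/-- The weight `V + c` with `c = τ / ν(1)` is contracted by the residual operator at the rate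
`(ϱ + c) / (1 + c)`. -/
theorem norm_residualOp_pow_le (hV : ∀ x, 1 ≤ V x)
    (hPV : ∃ C : ℝ, ∀ x, ∫⁻ y, ENNReal.ofReal (V y) ∂(P x) ≤ ENNReal.ofReal (C * V x))
    (hint : ∀ x, Integrable V (P x)) {ν : Measure X} [IsFiniteMeasure ν] (hν : Integrable V ν)
    {A : Set X} (hA : MeasurableSet A) (hνP : ∀ x ∈ A, ν ≤ P x) (hϱ₀ : 0 < ϱ) (hϱ₁ : ϱ < 1)
    (hle : ∀ x, ∫ y, V y ∂(P x) ≤ ϱ * V x + M * A.indicator (fun _ => 1) x) {c : ℝ} (hc : 0 ≤ c)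
    (hcM : M - ∫ x, V x ∂ν ≤ c * ν.real Set.univ) (n : ℕ) :
    ‖residualOp V hV P hPV hν hA ^ n‖ ≤ (1 + c) * ((ϱ + c) / (1 + c)) ^ n := by
  set α := (ϱ + c) / (1 + c) with hα
  have hα0 : 0 ≤ α := by positivity
  have hα1 : α * (1 + c) = ϱ + c := div_mul_cancel₀ _ (by positivity)
  have hϱα : ϱ ≤ α := by
    rw [hα, le_div_iff₀ (by positivity)]
    nlinarith
  refine BV.norm_pow_le (W := fun n x => α ^ n * (V x + c)) (D := fun n => (1 + c) * α ^ n)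
    (fun x => by simpa using hc) (fun n => by positivity) (fun n x => ?_) (fun n f k hk hf x => ?_) n
  · have h1 : V x + c ≤ (1 + c) * V x := by nlinarith [hV x]
    calc α ^ n * (V x + c) ≤ α ^ n * ((1 + c) * V x) := by gcongr
      _ = (1 + c) * α ^ n * V x := by ring
  · have hWP : ∀ {μ : Measure X} [IsFiniteMeasure μ], Integrable V μ →
        Integrable (fun y => k * (α ^ n * (V y + c))) μ := fun h =>
      ((h.add (integrable_const c)).const_mul _).const_mul k
    have hWint : ∀ {μ : Measure X} [IsFiniteMeasure μ], Integrable V μ →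
        ∫ y, k * (α ^ n * (V y + c)) ∂μ = k * (α ^ n * (∫ y, V y ∂μ + μ.real Set.univ * c)) := by
      intro μ _ h
      rw [integral_const_mul, integral_const_mul, integral_add h (integrable_const c),
        integral_const, smul_eq_mul]
    refine (norm_residualOp_apply_le hV hPV hν hA hνP (fun x => hWP (hint x)) f hf x).trans ?_
    rw [hWint (hint x), hWint hν, probReal_univ, one_mul]
    have hkey : ∫ y, V y ∂(P x) + c -
        (∫ y, V y ∂ν + ν.real Set.univ * c) * A.indicator (fun _ => 1) x ≤ α * (V x + c) := by
      have h1 : ϱ * V x + c ≤ α * (V x + c) := by nlinarith [hV x]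
      refine le_trans ?_ h1
      have h2 := hle x
      by_cases hx : x ∈ A
      · simp only [Set.indicator_of_mem hx, mul_one] at h2 ⊢
        linarith
      · simp only [Set.indicator_of_notMem hx, mul_zero] at h2 ⊢
        linarith
    calc _ = k * α ^ n * (∫ y, V y ∂(P x) + c -
          (∫ y, V y ∂ν + ν.real Set.univ * c) * A.indicator (fun _ => 1) x) := by ring
      _ ≤ k * α ^ n * (α * (V x + c)) := by gcongr
      _ = k * (α ^ (n + 1) * (V x + c)) := by ring

end DriftKernel

end

theorem theorem2p1 {X : Type*} [MeasurableSpace X]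
    (V : X → ℝ) (hVm : Measurable V) (hV : ∀ x, 1 ≤ V x)
    (P : Kernel X X) [IsMarkovKernel P]
    (hPV : ∃ C : ℝ, ∀ x, ∫⁻ y, ENNReal.ofReal (V y) ∂(P x) ≤ ENNReal.ofReal (C * V x))
    (S : Set X) (ϱ M : ℝ) (hϱ₀ : 0 < ϱ) (hϱ₁ : ϱ < 1) (hM : 0 < M)
    (hD : ∀ x, ∫⁻ y, ENNReal.ofReal (V y) ∂(P x) ≤
      ENNReal.ofReal (ϱ * V x + M * S.indicator (fun _ => (1 : ℝ)) x))
    (ν : Measure X) (hν : ν ≠ 0)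
    (hS : ∀ x, ∀ A, MeasurableSet A → S.indicator (fun _ => ν A) x ≤ P x A)
    (τ : ℝ) (hτ : τ = max 0 (M - ∫ x, V x ∂ν)) :
    IsPowerBounded (kernelOp V hV P hPV) ∧
    IsQuasiCompact (kernelOp V hV P hPV) ∧
    essSpectralRadius (kernelOp V hV P hPV) ≤
      (ϱ * ν.real Set.univ + τ) / (ν.real Set.univ + τ) ∧
    splittingRadius (kernelOp V hV P hPV) ≤
      (ϱ * ν.real Set.univ + τ) / (ν.real Set.univ + τ) := by
  have hX : Nonempty X := by
    by_contra h
    rw [not_nonempty_iff] at h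
    exact hν (Measure.eq_zero_of_isEmpty ν)
  have hint : ∀ x, Integrable V (P x) := fun x => integrable_weight_of_lintegral_le hVm hV (hD x)
  have hDint : ∀ x, ∫ y, V y ∂(P x) ≤ ϱ * V x + M * S.indicator (fun _ => (1 : ℝ)) x := fun x => by
    refine integral_weight_le_of_lintegral_le hVm hV ?_ (hD x)
    have h1 : 0 ≤ S.indicator (fun _ => (1 : ℝ)) x := Set.indicator_nonneg (fun _ _ => zero_le_one) x
    have h2 := hV x
    positivity
  -- The set `S` need not be measurable, so it is replaced by the measurable subset where the
  -- drift inequality `P V ≤ ϱ V` fails.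
  set A : Set X := {x | ϱ * V x < ∫ y, V y ∂(P x)} with hAdef
  have hA : MeasurableSet A := measurableSet_lt (hVm.const_mul ϱ)
    (hVm.stronglyMeasurable.integral_kernel (κ := P)).measurable
  have hAS : A ⊆ S := fun x hx => by
    by_contra hxS
    have h := hDint x
    rw [Set.indicator_of_notMem hxS, mul_zero, add_zero] at h
    exact absurd h (not_le.2 hx)
  have hνP : ∀ x ∈ A, ν ≤ P x := fun x hx => Measure.le_iff.2 fun B hB => by
    have h := hS x B hB
    rwa [Set.indicator_of_mem (hAS hx)] at h
  have hle : ∀ x, ∫ y, V y ∂(P x) ≤ ϱ * V x + M * A.indicator (fun _ => (1 : ℝ)) x := fun x => by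
    by_cases hx : x ∈ A
    · have h := hDint x
      rwa [Set.indicator_of_mem (hAS hx), ← Set.indicator_of_mem hx (fun _ => (1 : ℝ))] at h
    · rw [Set.indicator_of_notMem hx, mul_zero, add_zero]
      exact not_lt.1 hx
  obtain ⟨x₀, hx₀⟩ := exists_lt_integral_weight hV hint hϱ₀ hϱ₁
  have hνfin : IsFiniteMeasure ν := isFiniteMeasure_of_le (P x₀) (hνP x₀ hx₀)
  have hνV : Integrable V ν := (hint x₀).mono_measure (hνP x₀ hx₀)
  have : NeZero ν := ⟨hν⟩
  have hν0 : 0 < ν.real Set.univ := measureReal_univ_pos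
  have hτ0 : 0 ≤ τ := hτ ▸ le_max_left _ _
  have hcM : M - ∫ x, V x ∂ν ≤ τ / ν.real Set.univ * ν.real Set.univ := by
    rw [div_mul_cancel₀ _ hν0.ne', hτ]
    exact le_max_right _ _
  have hT := norm_residualOp_pow_le hV hPV hint hνV hA hνP hϱ₀ hϱ₁ hle
    (div_nonneg hτ0 hν0.le) hcM
  have hα : (ϱ + τ / ν.real Set.univ) / (1 + τ / ν.real Set.univ) =
      (ϱ * ν.real Set.univ + τ) / (ν.real Set.univ + τ) := by
    field_simp
  rw [hα] at hT
  set α := (ϱ * ν.real Set.univ + τ) / (ν.real Set.univ + τ) with hαdef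
  have hα0 : 0 ≤ α := by positivity
  have hα1 : α < 1 := by
    rw [hαdef, div_lt_one (by positivity)]
    nlinarith
  have hL : ∀ f, kernelOp V hV P hPV f =
      residualOp V hV P hPV hνV hA f + BV.integralCLM hνV f • BV.indicator hA := fun f =>
    (sub_add_cancel _ _).symm
  have h1 := one_mem_spectrum_kernelOp hV hPV
  refine ⟨isPowerBounded_kernelOp hV hPV hint hϱ₀ hϱ₁ hM fun x => ?_,
    isQuasiCompact_of_rankOne hα0 hα1 hT hL h1,
    essSpectralRadius_le_of_rankOne hα0 (by positivity) hT hL,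
    splittingRadius_le_of_rankOne hα0 hα1 hT hL h1⟩
  refine (hle x).trans ?_
  have h2 : A.indicator (fun _ => (1 : ℝ)) x ≤ 1 :=
    Set.indicator_le_self' (fun _ _ => zero_le_one) x
  nlinarith
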